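/- Let $p$ be an odd prime, let $m\ge 3$ be odd, let $l\ge 1$ be an integer with $\gcd(m,l)=1$, and let $\mathbb F_q$ be the field with $q=p^m$ elements, with trace $\mathrm{Tr}:\mathbb F_q\to\mathbb F_p$. Consider the linear code of length $p^m$ over $\mathbb F_p$, with coordinates indexed by $\mathbb F_q$, $$\mathcal C=\{(\mathrm{Tr}(ax^{p^l+1}+bx^2+cx)+h)_{x\in\mathbb F_q} : a,b,c\in\mathbb F_q,\ h\in\mathbb F_p\}$$ (this is the code $\overline{\mathcal C_1^{\perp}}^{\perp}$ attached to the cyclic code $\mathcal C_1=\{(\mathrm{Tr}(ax^{p^l+1}+bx^2+cx))_{x\in\mathbb F_q^*}\}$). Let $A_i$ be the number of codewords of $\mathcal C$ of Hamming weight $i$, and $\mathcal B_i$ the set of supports of these codewords. A (nontrivial, simple) $2$-$(v,k,\lambda)$ design is a set of $k$-subsets, called blocks, of a $v$-set, $2<k<v$, such that every $2$-subset lies in exactly $\lambda$ blocks. For each of the pairs $(i,\lambda)$ below, $i$ and $\lambda$ are natural numbers, $A_i\neq0$, $(\mathbb F_q,\mathcal B_i)$ is a $2$-$(p^m,i,\lambda)$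 design, and it has exactly $A_i/(p-1)$ blocks. If $m\ge5$: 1. $i=p^m-p^{m-1}-p^{\frac{m+1}2}$, $\lambda=\dfrac{p^{\frac{m-3}2}(p^{\frac{m-1}2}-p^{\frac{m-3}2}-1)(p^{m-1}-1)(p^m-p^{m-1}-p^{\frac{m+1}2}-1)}{2(p^2-1)}$; 2. $i=p^m-p^{m-1}-p^{\frac{m-1}2}(p-1)$, $\lambda=\dfrac{p^{m-2}(p^{m-1}-1)(p^m-p^{m-1}-p^{\frac{m+1}2}+p^{\frac{m-1}2}-1)}2$; 3. $i=p^m-p^{m-1}-p^{\frac{m-1}2}$, $\lambda=\dfrac{p^{\frac{m-1}2}(p^{\frac{m+1}2}-p^{\frac{m-1}2}-1)(p^m-p^{m-1}-p^{\frac{m-1}2}-1)(p^{m+2}-p^{m+1}-p^{m-2}-p^{\frac{m+1}2}+p^{\frac{m-3}2}+p^2)}{2(p^2-1)}$; 4. $i=p^m-p^{m-1}$, $\lambda=(p^m-p^{m-1}-1)(2p^{2m-1}-2p^{2m-2}+p^{2m-3}-p^{2m-4}+p^{m-1}-p^{m-2}+p^{m-3}+1)$; 5. $i=p^m-p^{m-1}+p^{\frac{m-1}2}$,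 $\lambda=\dfrac{p^{\frac{m-1}2}(p^{\frac{m+1}2}-p^{\frac{m-1}2}+1)(p^m-p^{m-1}+p^{\frac{m-1}2}-1)(p^{m+2}-p^{m+1}-p^{m-2}+p^{\frac{m+1}2}-p^{\frac{m-3}2}+p^2)}{2(p^2-1)}$; 6. $i=p^m-p^{m-1}+p^{\frac{m+1}2}$, $\lambda=\dfrac{p^{\frac{m-3}2}(p^{\frac{m-1}2}-p^{\frac{m-3}2}+1)(p^m-p^{m-1}+p^{\frac{m+1}2}-1)(p^{m-1}-1)}{2(p^2-1)}$; 7. $i=p^m-p^{m-1}+p^{\frac{m-1}2}(p-1)$, $\lambda=\dfrac{p^{m-2}(p^{m-1}-1)(p^m-p^{m-1}+p^{\frac{m-1}2}(p-1)-1)}2$. If $m=3$: 1. $i=p^3-2p^2$, $\lambda=\dfrac{(p-2)(p^3-2p^2-1)}2$; 2. $i=p^3-2p^2+p$, $\lambda=\dfrac{p(p^2-1)(p^3-2p^2+p-1)}2$; 3. $i=p^3-p^2-p$, $\lambda=\dfrac{p(p^2-p-1)(p^3-p^2-p-1)(p^5-p^4-p+1)}{2(p^2-1)}$. -/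

import Mathlib

/-- A (simple, nontrivial) `t`-`(v, k, lam)` design on the point set `P` with block set `Bl`:
`P` has `v` elements, `0 < t < k < v`, the blocks are `k`-subsets of `P`, and every `t`-subset of
`P` is contained in exactly `lam` blocks. -/
structure IsTDesign {P : Type*} [Fintype P] (Bl : Set (Finset P)) (t v k lam : ℕ) : Prop where
  card_points : Fintype.card P = v
  t_pos : 0 < t
  t_lt : t < k
  lt_v : k < v
  card_block : ∀ B ∈ Bl, B.card = k
  card_containing : ∀ T : Finset P, T.card = t → {B ∈ Bl | T ⊆ B}.ncard = lam

/-- The support of a word whose coordinates are indexed by `P`. -/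
def wordSupport {p : ℕ} {P : Type*} [Fintype P] (f : P → ZMod p) : Finset P :=
  Finset.univ.filter fun x => f x ≠ 0

/-- `weightCount C i` is the number `A_i` of codewords of Hamming weight `i` in the code `C`. -/
noncomputable def weightCount {p : ℕ} {P : Type*} [Fintype P]
    (C : Submodule (ZMod p) (P → ZMod p)) (i : ℕ) : ℕ :=
  {f : P → ZMod p | f ∈ C ∧ hammingNorm f = i}.ncard

/-- The set of the supports of all codewords of Hamming weight `i` in the code `C`. -/
def supportBlocks {p : ℕ} {P : Type*} [Fintype P]
    (C : Submodule (ZMod p) (P → ZMod p)) (i : ℕ) : Set (Finset P) :=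
  {B | ∃ f ∈ C, hammingNorm f = i ∧ wordSupport f = B}

/-- The linear code of all words `(Tr (a x^(p^l+1) + b x^2 + c x) + h)_{x ∈ F}` with
`a, b, c ∈ F` and `h ∈ 𝔽_p`, where `Tr` is the trace from `F` to `𝔽_p`. -/
noncomputable def traceCode (p l : ℕ) (F : Type*) [Field F] [Algebra (ZMod p) F] :
    Submodule (ZMod p) (F → ZMod p) :=
  letI tr : F → ZMod p := fun y => Algebra.trace (ZMod p) F y
  { carrier := {f | ∃ (a b c : F) (h : ZMod p),
      f = fun x => tr (a * x ^ (p ^ l + 1) + b * x ^ 2 + c * x) + h}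
    zero_mem' := ⟨0, 0, 0, 0, by funext x; simp [tr]⟩
    add_mem' := by
      rintro _ _ ⟨a, b, c, h, rfl⟩ ⟨a', b', c', h', rfl⟩
      refine ⟨a + a', b + b', c + c', h + h', ?_⟩
      funext x
      simp only [Pi.add_apply, tr, add_mul, map_add]
      ring
    smul_mem' := by
      rintro r _ ⟨a, b, c, h, rfl⟩
      refine ⟨r • a, r • b, r • c, r * h, ?_⟩
      funext x
      simp only [Pi.smul_apply, tr, smul_mul_assoc, ← smul_add, map_smul, smul_eq_mul, mul_add] }

open Finset

/-! ### Character sums and diagonal quadratic forms over a finite field of odd order. -/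

section FiniteFieldCounting

variable {K : Type*} [Field K] [Fintype K] [DecidableEq K]

/-! Write m = 2k+1, let σ be the l-th power of Frobenius and Q_{a,b}(x) = Tr(aσ(x)x + bx²). A
codeword is Q_{a,b} + φ + h with φ an arbitrary linear functional and h a constant. Its weight is
read off from its number of zeros. If φ is outside the range of the polar form, all values are
equally frequent. If φ is inside, completing the square reduces the count to representation numbers
of Q_{a,b}, which depend only on the rank and a sign (`exists_sign_card_quadraticForm`,
`sum_zeros_eq`).

A σ-analogue of the Wronskian shows that the radical of a nonzero form has dimension at most 2,
since gcd(m, l) = 1 makes 𝔽_p the fixed field of σ (`finrank_radical_le_two`). The numbers of forms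
of corank 0, 1, 2 then follow from three counts: of forms, of radical vectors, and of independent
pairs of radical vectors (`corankCount_eq`). The sign affects the distribution only in even rank,
that is in corank 1 for nonzero forms, and there the total number of zeros of all forms fixes the
sum of the signs. This gives the full weight distribution, stated as the sum of an arbitrary test
function `G` over p times the numbers of zeros (`sum_zeros_twistedForm`).

The code is invariant under the 2-transitive group of maps x ↦ αx + β, so the supports of words of a
fixed weight have constant pair degree. If f and g have the same support, pigeonhole gives a scalar
c for which f - c g has many zeros. For the weights in question these are more than a nonzero
codeword can have, so f = c g and there are A_i/(p-1) blocks. Double counting pairs in blocks then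
yields λ. All weights have the form (p-1)p^{2k} - δp^k with δ one of 0, ±1, ±(p-1), ±p; for m = 3
the pigeonhole margin is positive only when δ > 0, which leaves three designs. -/

theorem quadraticChar_mul_self_of_ne_zero {a : K} (ha : a ≠ 0) :
    quadraticChar K a * quadraticChar K a = 1 := by
  rw [← sq]; exact quadraticChar_sq_one ha

theorem sum_comp_sq (hK : ringChar K ≠ 2) (g : K → ℤ) :
    ∑ x : K, g (x ^ 2) = ∑ y : K, (1 + quadraticChar K y) * g y := by
  rw [← Finset.sum_fiberwise (s := univ) (g := fun x : K => x ^ 2)]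
  refine Finset.sum_congr rfl fun y _ => ?_
  have h := quadraticChar_card_sqrts hK y
  have h2 : ∑ x : K with x ^ 2 = y, g (x ^ 2) = ∑ x : K with x ^ 2 = y, g y :=
    Finset.sum_congr rfl fun x hx => by rw [(Finset.mem_filter.1 hx).2]
  rw [h2, Finset.sum_const, nsmul_eq_mul, add_comm 1, ← h]
  congr 3
  ext x; simp

theorem sum_comp_mul_sq (hK : ringChar K ≠ 2) (g : K → ℤ) {a : K} (ha : a ≠ 0) :
    ∑ x : K, g (a * x ^ 2) = ∑ y : K, (1 + quadraticChar K a * quadraticChar K y) * g y := by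
  rw [sum_comp_sq hK (fun y => g (a * y))]
  refine Fintype.sum_equiv (Equiv.mulLeft₀ a ha) _ _ fun y => ?_
  simp only [show Equiv.mulLeft₀ a ha y = a * y from rfl, map_mul, ← mul_assoc, quadraticChar_mul_self_of_ne_zero ha, one_mul]

theorem sum_quadraticChar_sub (hK : ringChar K ≠ 2) (t : K) :
    ∑ y : K, quadraticChar K (t - y) = 0 := by
  rw [← quadraticChar_sum_zero hK]
  exact Fintype.sum_equiv (Equiv.subLeft t) _ _ fun y => rfl

theorem sum_quadraticChar_sq : ∑ y : K, quadraticChar K y ^ 2 = (Fintype.card K : ℤ) - 1 := by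
  have h : ∀ y : K, quadraticChar K y ^ 2 = 1 - if y = 0 then 1 else 0 := by
    intro y
    by_cases hy : y = 0
    · simp [hy]
    · rw [quadraticChar_sq_one hy]; simp [hy]
  rw [Finset.sum_congr rfl fun y _ => h y]
  simp [Finset.sum_sub_distrib]

/-- For t ≠ 0 the substitution y ↦ ty turns the sum into the Jacobi sum J(χ, χ) = -χ(-1); for t = 0
it is χ(-1) times the sum of the χ(y)². -/
theorem sum_quadraticChar_mul_sub (hK : ringChar K ≠ 2) (t : K) :
    ∑ y : K, quadraticChar K y * quadraticChar K (t - y) =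
      quadraticChar K (-1) * ((if t = 0 then (Fintype.card K : ℤ) else 0) - 1) := by
  by_cases ht : t = 0
  · subst ht
    rw [if_pos rfl, ← sum_quadraticChar_sq, Finset.mul_sum]
    refine Finset.sum_congr rfl fun y _ => ?_
    rw [zero_sub, ← neg_one_mul y, map_mul]; ring
  · rw [if_neg ht]
    have h := jacobiSum_nontrivial_inv (quadraticChar_ne_one hK)
    rw [(quadraticChar_isQuadratic K).inv, jacobiSum] at h
    have h2 : ∑ y : K, quadraticChar K y * quadraticChar K (t - y) =
        ∑ y : K, quadraticChar K y * quadraticChar K (1 - y) := by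
      symm
      refine Fintype.sum_equiv (Equiv.mulLeft₀ t ht) _ _ fun y => ?_
      have e : t - t * y = t * (1 - y) := by ring
      simp only [show Equiv.mulLeft₀ t ht y = t * y from rfl, e, map_mul]
      linear_combination (- quadraticChar K y * quadraticChar K (1 - y)) *
        quadraticChar_mul_self_of_ne_zero ht
    rw [h2, h]; ring

/-- On {0, 1, -1} every function is a polynomial of degree at most 2, so the first two moments of
the quadratic character suffice. -/
theorem sum_comp_quadraticChar (hK : ringChar K ≠ 2) (g : ℤ → ℚ) :
    ∑ t : K, g (quadraticChar K t) =
      g 0 + ((Fintype.card K : ℚ) - 1) / 2 * (g 1 + g (-1)) := by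
  have h0 : ∑ t : K, (quadraticChar K t : ℚ) = 0 := by
    exact_mod_cast quadraticChar_sum_zero hK
  have h2 : ∑ t : K, (quadraticChar K t : ℚ) ^ 2 = (Fintype.card K : ℚ) - 1 := by
    exact_mod_cast sum_quadraticChar_sq (K := K)
  have key : ∀ t : K, g (quadraticChar K t) =
      g 0 + (quadraticChar K t : ℚ) * ((g 1 - g (-1)) / 2)
        + (quadraticChar K t : ℚ) ^ 2 * ((g 1 + g (-1)) / 2 - g 0) := by
    intro t
    rcases (quadraticChar_isQuadratic K) t with h | h | h <;> rw [h] <;> push_cast <;> ring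
  simp only [key, Finset.sum_add_distrib, ← Finset.sum_mul, h0, h2]
  simp; ring

/-- The number of zeros of a diagonal quadratic form translated by `t`. -/
theorem exists_sign_card_diagonal (hK : ringChar K ≠ 2) (n : ℕ) (w : Fin n → K) :
    ∃ ε : ℤ, (ε = 1 ∨ ε = -1) ∧ ∀ t : K,
      (Fintype.card K : ℤ) * (∑ x : Fin n → K, if ∑ i, w i * x i ^ 2 = t then 1 else 0) =
        (Fintype.card K : ℤ) ^ n + ε * (Fintype.card K : ℤ) ^ (n - #{i | w i ≠ 0} / 2) *
          (if Even #{i | w i ≠ 0} then (if t = 0 then (Fintype.card K : ℤ) else 0) - 1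
            else quadraticChar K t) := by
  induction n with
  | zero =>
    refine ⟨1, Or.inl rfl, fun t => ?_⟩
    by_cases ht : t = 0
    · simp [ht]
    · simp [ht, Ne.symm ht]
  | succ n ih =>
    obtain ⟨ε, hε, ih⟩ := ih (fun i => w i.succ)
    set N : K → ℤ := fun t => ∑ x : Fin n → K, if ∑ i, w i.succ * x i ^ 2 = t then 1 else 0
      with hN
    set r := #{i : Fin n | w i.succ ≠ 0} with hr
    have hrn : r ≤ n := (Finset.card_le_univ _).trans (by simp)
    have hcard : #{i : Fin (n + 1) | w i ≠ 0} = (if w 0 ≠ 0 then 1 else 0) + r := by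
      rw [Fin.card_filter_univ_succ]; split_ifs <;> simp [hr, add_comm]
    have hrec : ∀ t, (∑ x : Fin (n + 1) → K, if ∑ i, w i * x i ^ 2 = t then (1 : ℤ) else 0) =
        ∑ y : K, N (t - w 0 * y ^ 2) := by
      intro t
      rw [← (Fin.consEquiv (fun _ => K)).sum_comp, Fintype.sum_prod_type]
      refine Finset.sum_congr rfl fun y _ => Finset.sum_congr rfl fun x _ => ?_
      simp only [Fin.consEquiv_apply, Fin.sum_univ_succ, Fin.cons_zero, Fin.cons_succ,
        eq_sub_iff_add_eq']
    have hr2 : r / 2 ≤ n := (Nat.div_le_self _ _).trans hrn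
    -- A variable of weight 0 is free and multiplies every count by q. Otherwise the count is
    -- convolved with 1 + χ(w₀)χ, which swaps the two shapes: q·1_{t=0} - 1 in even rank becomes a
    -- multiple of χ(t), and conversely.
    by_cases h0 : w 0 = 0
    · refine ⟨ε, hε, fun t => ?_⟩
      have hc : #{i : Fin (n + 1) | w i ≠ 0} = r := by rw [hcard]; simp [h0]
      rw [hrec, hc]
      simp only [h0, zero_mul, sub_zero, Finset.sum_const, Finset.card_univ, nsmul_eq_mul]
      have := ih t
      rw [Nat.sub_add_comm hr2, pow_succ, pow_succ]
      linear_combination (Fintype.card K : ℤ) * this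
    · have hc : #{i : Fin (n + 1) | w i ≠ 0} = 1 + r := by rw [hcard]; simp [h0]
      have hstep : ∀ t, (Fintype.card K : ℤ) * ∑ y : K, N (t - w 0 * y ^ 2) =
          ∑ y : K, (1 + quadraticChar K (w 0) * quadraticChar K y) *
            ((Fintype.card K : ℤ) * N (t - y)) := by
        intro t
        rw [sum_comp_mul_sq hK (fun y => N (t - y)) h0, Finset.mul_sum]
        exact Finset.sum_congr rfl fun y _ => by ring
      have hχ : ∀ a : K, a ≠ 0 → quadraticChar K a = 1 ∨ quadraticChar K a = -1 :=
        fun a ha => quadraticChar_dichotomy ha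
      by_cases hev : Even r
      · refine ⟨ε * quadraticChar K (w 0), ?_, fun t => ?_⟩
        · rcases hε with rfl | rfl <;> rcases hχ _ h0 with h | h <;> simp [h]
        · rw [hrec, hstep, hc]
          have hod : ¬ Even (1 + r) := by
            rw [Nat.not_even_iff_odd, add_comm]; exact hev.add_one
          have hd : (1 + r) / 2 = r / 2 := by obtain ⟨u, hu⟩ := hev; omega
          simp only [hN, ih, if_pos hev, if_neg hod, hd]
          rw [Nat.sub_add_comm hr2, pow_succ, pow_succ]
          have e : ∀ y : K, (1 + quadraticChar K (w 0) * quadraticChar K y) *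
              ((Fintype.card K : ℤ) ^ n + ε * (Fintype.card K : ℤ) ^ (n - r / 2) *
                ((if t - y = 0 then (Fintype.card K : ℤ) else 0) - 1)) =
              ((Fintype.card K : ℤ) ^ n - ε * (Fintype.card K : ℤ) ^ (n - r / 2)) +
              ((Fintype.card K : ℤ) ^ n - ε * (Fintype.card K : ℤ) ^ (n - r / 2)) *
                quadraticChar K (w 0) * quadraticChar K y +
              (if t = y then ε * (Fintype.card K : ℤ) ^ (n - r / 2) * (Fintype.card K : ℤ) *
                (1 + quadraticChar K (w 0) * quadraticChar K y) else 0) := by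
            intro y
            simp only [sub_eq_zero]
            split_ifs <;> ring
          simp only [e, Finset.sum_add_distrib, ← Finset.mul_sum, quadraticChar_sum_zero hK,
            Finset.sum_ite_eq, Finset.mem_univ, if_true, Finset.sum_const, Finset.card_univ,
            nsmul_eq_mul]
          ring
      · have hod : Even (1 + r) := by
          rw [add_comm]; exact (Nat.not_even_iff_odd.1 hev).add_one
        refine ⟨ε * quadraticChar K (w 0) * quadraticChar K (-1), ?_, fun t => ?_⟩
        · rcases hε with rfl | rfl <;> rcases hχ _ h0 with h | h <;>
            rcases hχ (-1) (by simp) with h' | h' <;> simp [h, h']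
        · rw [hrec, hstep, hc]
          have hd : n + 1 - (1 + r) / 2 = n - r / 2 := by
            have := Nat.not_even_iff_odd.1 hev
            obtain ⟨u, hu⟩ := this; omega
          simp only [hN, ih, if_pos hod, if_neg hev, hd]
          have e : ∀ y : K, (1 + quadraticChar K (w 0) * quadraticChar K y) *
              ((Fintype.card K : ℤ) ^ n + ε * (Fintype.card K : ℤ) ^ (n - r / 2) *
                quadraticChar K (t - y)) =
              (Fintype.card K : ℤ) ^ n +
              (Fintype.card K : ℤ) ^ n * quadraticChar K (w 0) * quadraticChar K y +
              ε * (Fintype.card K : ℤ) ^ (n - r / 2) * quadraticChar K (t - y) +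
              ε * (Fintype.card K : ℤ) ^ (n - r / 2) * quadraticChar K (w 0) *
                (quadraticChar K y * quadraticChar K (t - y)) := by
            intro y; ring
          simp only [e, Finset.sum_add_distrib, ← Finset.mul_sum, quadraticChar_sum_zero hK,
            sum_quadraticChar_sub hK, sum_quadraticChar_mul_sub hK, Finset.sum_const,
            Finset.card_univ, nsmul_eq_mul]
          ring

end FiniteFieldCounting

/-! ### Zeros of a quadratic form plus an affine functional. -/

section QuadraticFormCounting

variable {K : Type*} [Field K] [Fintype K] [DecidableEq K]
  {V : Type*} [AddCommGroup V] [Module K V] [Fintype V]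

/-- The polar form is 2∑ wᵢxᵢyᵢ, so the radical is the coordinate subspace where xᵢ = 0 whenever wᵢ
≠ 0. This identifies the number of nonzero weights with the rank. -/
theorem card_diagonal_radical (hK : ringChar K ≠ 2) (n : ℕ) (w : Fin n → K) :
    Nat.card {x : Fin n → K // ∀ y, QuadraticMap.polar
      (QuadraticMap.weightedSumSquares K w) x y = 0} =
      Fintype.card K ^ (n - #{i | w i ≠ 0}) := by
  have h2 : (2 : K) ≠ 0 := Ring.two_ne_zero hK
  have hpol : ∀ x y : Fin n → K, QuadraticMap.polar (QuadraticMap.weightedSumSquares K w) x y =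
      ∑ i, 2 * w i * x i * y i := by
    intro x y
    simp only [QuadraticMap.polar, QuadraticMap.weightedSumSquares_apply, Pi.add_apply,
      smul_eq_mul, ← Finset.sum_sub_distrib]
    exact Finset.sum_congr rfl fun i _ => by ring
  have hiff : ∀ x : Fin n → K,
      (∀ y, QuadraticMap.polar (QuadraticMap.weightedSumSquares K w) x y = 0) ↔
        x ∈ Fintype.piFinset (fun i => if w i ≠ 0 then ({0} : Finset K) else Finset.univ) := by
    intro x
    simp only [hpol, Fintype.mem_piFinset]
    constructor
    · intro h i
      have := h (Pi.single i 1)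
      rw [Finset.sum_eq_single i (fun j _ hj => by simp [hj]) (by simp)] at this
      split_ifs with hw
      · simpa [h2, hw] using this
      · simp
    · intro h y
      refine Finset.sum_eq_zero fun i _ => ?_
      have := h i
      by_cases hw : w i = 0
      · simp [hw]
      · rw [if_pos hw] at this
        simp [Finset.mem_singleton.1 this]
  rw [Nat.card_congr (Equiv.subtypeEquivRight hiff), Nat.card_eq_fintype_card, Fintype.card_coe,
    Fintype.card_piFinset]
  have : ∀ i, #(if w i ≠ 0 then ({0} : Finset K) else Finset.univ) =
      if w i ≠ 0 then 1 else Fintype.card K := by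
    intro i; split_ifs <;> simp
  simp only [this]
  rw [Finset.prod_ite, Finset.prod_const_one, one_mul, Finset.prod_const]
  congr 1
  have := Finset.card_filter_add_card_filter_not (s := (univ : Finset (Fin n))) (fun i => w i ≠ 0)
  simp only [Finset.card_univ, Fintype.card_fin] at this
  omega

/-- The number of representations by a quadratic form of rank `r` over a finite field. -/
theorem exists_sign_card_quadraticForm (hK : ringChar K ≠ 2) (Q : QuadraticForm K V) {n r e : ℕ}
    (hn : Fintype.card V = Fintype.card K ^ n) (hre : r + e = n)
    (hrad : Nat.card (LinearMap.ker Q.polarBilin) = Fintype.card K ^ e) :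
    ∃ ε : ℤ, (ε = 1 ∨ ε = -1) ∧ ∀ t : K,
      (Fintype.card K : ℤ) * #{x | Q x = t} =
        (Fintype.card K : ℤ) ^ n + ε * (Fintype.card K : ℤ) ^ (n - r / 2) *
          (if Even r then (if t = 0 then (Fintype.card K : ℤ) else 0) - 1
            else quadraticChar K t) := by
  have hq : 1 < Fintype.card K := Fintype.one_lt_card
  have : Invertible (2 : K) := invertibleOfNonzero (Ring.two_ne_zero hK)
  have : Module.Finite K V := Module.Finite.of_finite
  have hfr : Module.finrank K V = n := by
    have := Module.card_eq_pow_finrank (K := K) (V := V)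
    rw [hn] at this
    exact (Nat.pow_right_injective hq this).symm
  obtain ⟨w, ⟨f⟩⟩ := Q.equivalent_weightedSumSquares
  subst hfr
  have hpol : ∀ x y, QuadraticMap.polar (QuadraticMap.weightedSumSquares K w) (f x) (f y) =
      QuadraticMap.polar Q x y := by
    intro x y
    simp only [QuadraticMap.polar, ← map_add, QuadraticMap.IsometryEquiv.map_app]
  have hr : #{i | w i ≠ 0} = r := by
    have h1 := card_diagonal_radical hK _ w
    have h2 : Nat.card (LinearMap.ker Q.polarBilin) =
        Nat.card {x : Fin (Module.finrank K V) → K // ∀ y, QuadraticMap.polar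
          (QuadraticMap.weightedSumSquares K w) x y = 0} := by
      refine Nat.card_congr (f.toLinearEquiv.toEquiv.subtypeEquiv fun x => ?_)
      rw [LinearMap.mem_ker, LinearMap.ext_iff]
      constructor
      · intro h y
        obtain ⟨y, rfl⟩ := f.toLinearEquiv.surjective y
        exact (hpol x y).trans (h y)
      · intro h y
        exact (hpol x y).symm.trans (h (f y))
    rw [h2, h1] at hrad
    have h3 := Nat.pow_right_injective hq hrad
    have h4 : #{i | w i ≠ 0} ≤ Module.finrank K V := (Finset.card_le_univ _).trans (by simp)
    omega
  obtain ⟨ε, hε, h⟩ := exists_sign_card_diagonal hK _ w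
  refine ⟨ε, hε, fun t => ?_⟩
  rw [hr] at h
  rw [← h t]
  congr 1
  rw [Finset.card_filter, ← f.toLinearEquiv.toEquiv.sum_comp]
  push_cast
  refine Finset.sum_congr rfl fun x _ => ?_
  have : (∑ i, w i * (f x) i ^ 2) = Q x := by
    rw [← f.map_app x, QuadraticMap.weightedSumSquares_apply]
    exact Finset.sum_congr rfl fun i _ => by rw [smul_eq_mul, sq]
  exact if_congr (by rw [← this]; rfl) rfl rfl

/-- The polar form is symmetric, hence its own transpose, and the range of a transpose is the
annihilator of the kernel. -/
theorem mem_range_polarBilin_of_forall (Q : QuadraticForm K V) (φ : Module.Dual K V)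
    (h : ∀ x ∈ LinearMap.ker Q.polarBilin, φ x = 0) : φ ∈ LinearMap.range Q.polarBilin := by
  have : Module.Finite K V := Module.Finite.of_finite
  have h1 : φ ∈ (LinearMap.ker Q.polarBilin).dualAnnihilator := by
    rw [Submodule.mem_dualAnnihilator]; exact h
  rw [← LinearMap.range_dualMap_eq_dualAnnihilator_ker] at h1
  obtain ⟨g, hg⟩ := h1
  obtain ⟨y, rfl⟩ := (Module.evalEquiv K V).surjective g
  refine ⟨y, ?_⟩
  rw [← hg]
  ext x
  exact QuadraticMap.polar_comm _ _ _

/-- A function on which translation by `x₀` acts by adding `c ≠ 0` takes all values equally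
often. -/
theorem card_mul_card_zeros_of_translate (g : V → K) (x₀ : V) {c : K} (hc : c ≠ 0)
    (hg : ∀ x (s : K), g (x + s • x₀) = g x + s * c) :
    Fintype.card K * #{x | g x = 0} = Fintype.card V := by
  have key : ∀ t : K, #{x | g x = t} = #{x | g x = 0} := by
    intro t
    refine Finset.card_bij' (fun x _ => x + (-(t / c)) • x₀) (fun x _ => x + (t / c) • x₀)
      ?_ ?_ ?_ ?_
    · intro x hx
      simp only [Finset.mem_filter, Finset.mem_univ, true_and] at hx ⊢
      rw [hg, hx]; field_simp; ring
    · intro x hx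
      simp only [Finset.mem_filter, Finset.mem_univ, true_and] at hx ⊢
      rw [hg, hx]; field_simp; ring
    · intro x _; simp
    · intro x _; simp
  have := Finset.card_eq_sum_card_fiberwise (f := g) (s := univ) (t := univ) (by simp)
  rw [Finset.card_univ] at this
  rw [this, Finset.sum_congr rfl fun t _ => key t]
  simp

/-- Such a φ is nonzero at some x₀ in the radical. As 2 ≠ 0, Q vanishes at x₀ and is invariant under
translation by multiples of x₀, so the function moves by sφ(x₀). -/
theorem card_mul_card_zeros_of_notMem_range (hK : ringChar K ≠ 2) (Q : QuadraticForm K V)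
    (φ : Module.Dual K V) (h : K) (hφ : φ ∉ LinearMap.range Q.polarBilin) :
    Fintype.card K * #{x | Q x + φ x + h = 0} = Fintype.card V := by
  have h2 : (2 : K) ≠ 0 := Ring.two_ne_zero hK
  have : ∃ x ∈ LinearMap.ker Q.polarBilin, φ x ≠ 0 := by
    by_contra! hcon
    exact hφ (mem_range_polarBilin_of_forall Q φ hcon)
  obtain ⟨x₀, hx₀, hne⟩ := this
  have hp : ∀ y, QuadraticMap.polar Q x₀ y = 0 := fun y => by
    have := LinearMap.mem_ker.1 hx₀
    exact LinearMap.congr_fun this y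
  have hQ : Q x₀ = 0 := by
    have := hp x₀
    rw [QuadraticMap.polar_self, nsmul_eq_mul] at this
    simpa [h2] using this
  refine card_mul_card_zeros_of_translate _ x₀ hne fun x s => ?_
  have e : Q (x + s • x₀) = Q x := by
    rw [QuadraticMap.map_add Q, QuadraticMap.map_smul, hQ, QuadraticMap.polar_smul_right,
      QuadraticMap.polar_comm, hp]
    simp
  rw [e, map_add, map_smul, smul_eq_mul]; ring

/-- Completing the square: if φ is the polar form at y, then Q(x) + φ(x) + h = Q(x + y) - Q(y) + h.
-/
theorem sum_zeros_of_mem_range (Q : QuadraticForm K V) (φ : Module.Dual K V)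
    (hφ : φ ∈ LinearMap.range Q.polarBilin) (G : ℕ → ℚ) :
    ∑ h : K, G #{x | Q x + φ x + h = 0} = ∑ t : K, G #{x | Q x = t} := by
  obtain ⟨y, rfl⟩ := hφ
  have key : ∀ h : K, #{x | Q x + Q.polarBilin y x + h = 0} = #{x | Q x = Q y - h} := by
    intro h
    refine Finset.card_equiv (Equiv.addRight y) fun x => ?_
    simp only [Finset.mem_filter, Finset.mem_univ, true_and, Equiv.coe_addRight,
      QuadraticMap.map_add, QuadraticMap.polar_comm Q x y, QuadraticMap.polarBilin_apply_apply]
    rw [eq_sub_iff_add_eq, ← sub_eq_zero (b := Q y)]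
    ring_nf
  simp only [key]
  exact Fintype.sum_equiv (Equiv.subLeft (Q y)) _ _ fun h => rfl

theorem card_range_polarBilin (Q : QuadraticForm K V) {n r e : ℕ}
    (hn : Fintype.card V = Fintype.card K ^ n) (hre : r + e = n)
    (hrad : Nat.card (LinearMap.ker Q.polarBilin) = Fintype.card K ^ e) :
    Nat.card (LinearMap.range Q.polarBilin) = Fintype.card K ^ r := by
  have h := Submodule.card_eq_card_quotient_mul_card (LinearMap.ker Q.polarBilin)
  rw [Nat.card_congr Q.polarBilin.quotKerEquivRange.toEquiv, Nat.card_eq_fintype_card, hn, hrad,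
    ← hre, pow_add] at h
  rw [mul_comm] at h
  exact (Nat.eq_of_mul_eq_mul_left (pow_pos Fintype.card_pos e) h).symm

theorem card_dual_eq : Nat.card (Module.Dual K V) = Fintype.card V := by
  have : Module.Finite K V := Module.Finite.of_finite
  rw [Module.natCard_eq_pow_finrank (K := K), Subspace.dual_finrank_eq,
    Module.card_eq_pow_finrank (K := K) (V := V), Nat.card_eq_fintype_card]

/-- The distribution of the numbers of zeros of the functions `Q + φ + h`, for a fixed quadratic
form `Q`, in terms of the numbers of representations by `Q`. -/
theorem sum_zeros_eq (hK : ringChar K ≠ 2) (Q : QuadraticForm K V) {n r e : ℕ}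
    (hn : Fintype.card V = Fintype.card K ^ n) (hre : r + e = n)
    (hrad : Nat.card (LinearMap.ker Q.polarBilin) = Fintype.card K ^ e)
    [Fintype (Module.Dual K V)] (G : ℤ → ℚ) :
    ∑ φ : Module.Dual K V, ∑ h : K, G ((Fintype.card K : ℤ) * #{x | Q x + φ x + h = 0}) =
      ((Fintype.card K : ℚ) ^ n - (Fintype.card K : ℚ) ^ r) * Fintype.card K *
        G ((Fintype.card K : ℤ) ^ n) +
      (Fintype.card K : ℚ) ^ r * ∑ t : K, G ((Fintype.card K : ℤ) * #{x | Q x = t}) := by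
  classical
  have hin : ∀ φ : Module.Dual K V,
      ∑ h : K, G ((Fintype.card K : ℤ) * #{x | Q x + φ x + h = 0}) =
      if φ ∈ LinearMap.range Q.polarBilin then
        ∑ t : K, G ((Fintype.card K : ℤ) * #{x | Q x = t})
      else (Fintype.card K : ℚ) * G ((Fintype.card K : ℤ) ^ n) := by
    intro φ
    split_ifs with hφ
    · exact sum_zeros_of_mem_range Q φ hφ fun N => G ((Fintype.card K : ℤ) * N)
    · have : ∀ h : K, (Fintype.card K : ℤ) * #{x | Q x + φ x + h = 0} =
          (Fintype.card K : ℤ) ^ n := by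
        intro h
        have := card_mul_card_zeros_of_notMem_range hK Q φ h hφ
        rw [hn] at this
        exact_mod_cast this
      simp [this]
  have hc1 : #{φ : Module.Dual K V | φ ∈ LinearMap.range Q.polarBilin} = Fintype.card K ^ r := by
    rw [← card_range_polarBilin Q hn hre hrad, Nat.card_eq_fintype_card, Fintype.card_subtype]
  have hc2 : (#{φ : Module.Dual K V | ¬ φ ∈ LinearMap.range Q.polarBilin} : ℚ) =
      (Fintype.card K : ℚ) ^ n - (Fintype.card K : ℚ) ^ r := by
    have := Finset.card_filter_add_card_filter_not (s := (univ : Finset (Module.Dual K V)))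
      (fun φ => φ ∈ LinearMap.range Q.polarBilin)
    rw [hc1, Finset.card_univ, ← Nat.card_eq_fintype_card (α := Module.Dual K V), card_dual_eq,
      hn] at this
    rw [eq_sub_iff_add_eq']
    exact_mod_cast this
  simp only [hin]
  rw [Finset.sum_ite, Finset.sum_const, Finset.sum_const, nsmul_eq_mul, nsmul_eq_mul, hc1, hc2]
  push_cast
  ring

/-- In odd rank the count depends on t through εχ(t). Since χ takes the values 1 and -1 equally
often, the sign ε drops out. -/
theorem sum_zeros_of_odd_rank (hK : ringChar K ≠ 2) (Q : QuadraticForm K V) {n r e : ℕ}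
    (hn : Fintype.card V = Fintype.card K ^ n) (hre : r + e = n) (hr : Odd r)
    (hrad : Nat.card (LinearMap.ker Q.polarBilin) = Fintype.card K ^ e)
    [Fintype (Module.Dual K V)] (G : ℤ → ℚ) :
    ∑ φ : Module.Dual K V, ∑ h : K, G ((Fintype.card K : ℤ) * #{x | Q x + φ x + h = 0}) =
      ((Fintype.card K : ℚ) ^ n - (Fintype.card K : ℚ) ^ r) * Fintype.card K *
        G ((Fintype.card K : ℤ) ^ n) +
      (Fintype.card K : ℚ) ^ r * (G ((Fintype.card K : ℤ) ^ n) + ((Fintype.card K : ℚ) - 1) / 2 *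
        (G ((Fintype.card K : ℤ) ^ n + (Fintype.card K : ℤ) ^ (n - r / 2)) +
          G ((Fintype.card K : ℤ) ^ n - (Fintype.card K : ℤ) ^ (n - r / 2)))) := by
  rw [sum_zeros_eq hK Q hn hre hrad]
  obtain ⟨ε, hε, h⟩ := exists_sign_card_quadraticForm hK Q hn hre hrad
  simp only [h, if_neg (Nat.not_even_iff_odd.2 hr)]
  rw [sum_comp_quadraticChar hK (fun z => G ((Fintype.card K : ℤ) ^ n +
    ε * (Fintype.card K : ℤ) ^ (n - r / 2) * z))]
  rcases hε with rfl | rfl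
  · simp [sub_eq_add_neg]
  · simp [sub_eq_add_neg, add_comm]

/-- For a quadratic form of even rank there is a sign `ε` which determines the number of its zeros
and the distribution of the numbers of zeros of the functions `Q + φ + h`. -/
theorem exists_sign_sum_zeros_of_even_rank (hK : ringChar K ≠ 2) (Q : QuadraticForm K V)
    {n r e : ℕ} (hn : Fintype.card V = Fintype.card K ^ n) (hre : r + e = n) (hr : Even r)
    (hrad : Nat.card (LinearMap.ker Q.polarBilin) = Fintype.card K ^ e)
    [Fintype (Module.Dual K V)] :
    ∃ ε : ℤ, (ε = 1 ∨ ε = -1) ∧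
      (Fintype.card K : ℤ) * #{x | Q x = 0} = (Fintype.card K : ℤ) ^ n +
        ε * (((Fintype.card K : ℤ) - 1) * (Fintype.card K : ℤ) ^ (n - r / 2)) ∧
      ∀ G : ℤ → ℚ,
      ∑ φ : Module.Dual K V, ∑ h : K, G ((Fintype.card K : ℤ) * #{x | Q x + φ x + h = 0}) =
      ((Fintype.card K : ℚ) ^ n - (Fintype.card K : ℚ) ^ r) * Fintype.card K *
        G ((Fintype.card K : ℤ) ^ n) +
      (Fintype.card K : ℚ) ^ r *
        (G ((Fintype.card K : ℤ) ^ n +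
          ε * (((Fintype.card K : ℤ) - 1) * (Fintype.card K : ℤ) ^ (n - r / 2))) +
        ((Fintype.card K : ℚ) - 1) * G ((Fintype.card K : ℤ) ^ n -
          ε * (Fintype.card K : ℤ) ^ (n - r / 2))) := by
  obtain ⟨ε, hε, h⟩ := exists_sign_card_quadraticForm hK Q hn hre hrad
  refine ⟨ε, hε, ?_, fun G => ?_⟩
  · rw [h, if_pos hr, if_pos rfl]; ring
  rw [sum_zeros_eq hK Q hn hre hrad]
  simp only [h, if_pos hr]
  rw [← Finset.add_sum_erase _ _ (Finset.mem_univ (0 : K)), if_pos rfl]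
  rw [Finset.sum_congr rfl (g := fun _ => G ((Fintype.card K : ℤ) ^ n -
          ε * (Fintype.card K : ℤ) ^ (n - r / 2)))]
  · rw [Finset.sum_const, Finset.card_erase_of_mem (Finset.mem_univ _), Finset.card_univ,
      nsmul_eq_mul, Nat.cast_sub Fintype.card_pos, Nat.cast_one]
    ring_nf
  · intro t ht
    rw [if_neg (Finset.ne_of_mem_erase ht)]
    ring_nf

end QuadraticFormCounting

/-! ### The forms Tr(aσ(x)x + bx²) and their radicals. -/

section TwistedForms

variable {K : Type*} [Field K] {F : Type*} [Field F] [Algebra K F]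

/-- The quadratic form `x ↦ Tr (a σ(x) x + b x ^ 2)`. -/
noncomputable def twistedForm (σ : F ≃ₐ[K] F) (a b : F) : QuadraticForm K F :=
  LinearMap.BilinMap.toQuadraticMap
    (LinearMap.mk₂ K (fun x y => Algebra.trace K F (a * σ x * y + b * x * y))
      (fun x x' y => by rw [← map_add]; congr 1; rw [map_add]; ring)
      (fun c x y => by
        rw [← map_smul]; congr 1; simp only [Algebra.smul_def, map_mul, AlgEquiv.commutes]; ring)
      (fun x y y' => by rw [← map_add]; congr 1; ring)
      (fun c x y => by rw [← map_smul]; congr 1; simp only [Algebra.smul_def]; ring))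

theorem twistedForm_apply (σ : F ≃ₐ[K] F) (a b x : F) :
    twistedForm σ a b x = Algebra.trace K F (a * σ x * x + b * x * x) := rfl

/-- The linear polynomial in `σ` whose zeros form the radical of `twistedForm σ a b`. -/
def radicalEquation (σ : F ≃ₐ[K] F) (a b x : F) : F :=
  σ (a * σ x) + a * x + σ (2 * b * x)

/-- A `σ`-analogue of the Wronskian. -/
def twistedWronskian (σ : F ≃ₐ[K] F) (x y : F) : F := y * σ x - x * σ y

/-- The trace is σ-invariant, so each term can be paired with σ(y); the radical is then cut out by
an equation free of σ⁻¹. -/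
theorem polar_twistedForm (σ : F ≃ₐ[K] F) (a b x y : F) :
    QuadraticMap.polar (twistedForm σ a b) x y =
      Algebra.trace K F (radicalEquation σ a b x * σ y) := by
  have h1 : Algebra.trace K F (radicalEquation σ a b x * σ y) =
      Algebra.trace K F (a * σ x * y) + Algebra.trace K F (a * x * σ y) +
        Algebra.trace K F (2 * b * x * y) := by
    rw [← Algebra.trace_eq_of_algEquiv σ (a * σ x * y),
      ← Algebra.trace_eq_of_algEquiv σ (2 * b * x * y), ← map_add, ← map_add]
    congr 1
    simp only [radicalEquation, map_mul]; ring
  rw [h1]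
  simp only [QuadraticMap.polar, twistedForm_apply]
  rw [← map_add, ← map_add, ← map_sub, ← map_sub]
  congr 1
  rw [map_add]; ring

/-- Cross-multiplying the radical equations of x and y by σ(y) and σ(x) eliminates b and leaves
σ(aW) - aW. -/
theorem mul_twistedWronskian_fixed (σ : F ≃ₐ[K] F) {a b x y : F}
    (hx : radicalEquation σ a b x = 0) (hy : radicalEquation σ a b y = 0) :
    σ (a * twistedWronskian σ x y) = a * twistedWronskian σ x y := by
  simp only [radicalEquation, twistedWronskian, map_mul, map_sub] at *
  linear_combination σ y * hx - σ x * hy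

theorem radicalEquation_of_fixed (σ : F ≃ₐ[K] F) {a b x y : F} (hx0 : x ≠ 0)
    (hx : radicalEquation σ a b x = 0)
    (h : σ (a * twistedWronskian σ x y) = a * twistedWronskian σ x y) :
    radicalEquation σ a b y = 0 := by
  have h0 : σ x ≠ 0 := by simpa using hx0
  apply mul_left_cancel₀ h0
  simp only [radicalEquation, twistedWronskian, map_mul, map_sub] at *
  linear_combination σ y * hx - h

/-- The Wronskian vanishes exactly when y/x is fixed by σ, hence a scalar. For x ≠ 0 its
nonvanishing therefore means linear independence over K. -/
theorem twistedWronskian_eq_zero_iff (σ : F ≃ₐ[K] F)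
    (hσ : ∀ x, σ x = x → x ∈ Set.range (algebraMap K F)) {x y : F} (hx : x ≠ 0) :
    twistedWronskian σ x y = 0 ↔ ∃ c : K, c • x = y := by
  have h0 : σ x ≠ 0 := by simpa using hx
  constructor
  · intro h
    obtain ⟨c, hc⟩ := hσ (y / x) (by
      rw [map_div₀, div_eq_div_iff h0 hx]
      rw [twistedWronskian, sub_eq_zero] at h
      rw [h]; ring)
    exact ⟨c, by rw [Algebra.smul_def, hc]; field_simp⟩
  · rintro ⟨c, rfl⟩
    simp only [twistedWronskian, Algebra.smul_def, map_mul, AlgEquiv.commutes]; ring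

/-- The unique `b` for which `x` lies in the radical of `twistedForm σ a b`. -/
def radicalCoefficient (σ : F ≃ₐ[K] F) (x a : F) : F :=
  σ.symm (-(σ (a * σ x) + a * x)) / (2 * x)

theorem radicalEquation_eq_zero_iff (hF2 : (2 : F) ≠ 0) (σ : F ≃ₐ[K] F) {x : F} (hx : x ≠ 0)
    (a b : F) : radicalEquation σ a b x = 0 ↔ b = radicalCoefficient σ x a := by
  rw [radicalEquation, radicalCoefficient, eq_div_iff (mul_ne_zero hF2 hx),
    AlgEquiv.eq_symm_apply, show b * (2 * x) = 2 * b * x by ring, eq_neg_iff_add_eq_zero, add_comm]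

variable [Fintype K] [Fintype F]

theorem mem_ker_polarBilin_twistedForm (σ : F ≃ₐ[K] F) (a b x : F) :
    x ∈ LinearMap.ker (twistedForm σ a b).polarBilin ↔ radicalEquation σ a b x = 0 := by
  rw [LinearMap.mem_ker, LinearMap.ext_iff]
  constructor
  · intro h
    have hnd := traceForm_nondegenerate K F
    refine hnd.1 _ fun z => ?_
    obtain ⟨y, rfl⟩ := σ.surjective z
    have := h y
    rw [QuadraticMap.polarBilin_apply_apply, polar_twistedForm] at this
    simpa [Algebra.traceForm_apply] using this
  · intro h y
    rw [QuadraticMap.polarBilin_apply_apply, polar_twistedForm, h]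
    simp

/-- For a nonzero radical vector x, the map y ↦ aW(x, y) sends the radical into the fixed line K·1
and its kernel there is Kx. -/
theorem finrank_radical_le_two (hF2 : (2 : F) ≠ 0) (σ : F ≃ₐ[K] F)
    (hσ : ∀ x, σ x = x → x ∈ Set.range (algebraMap K F)) {a b : F} (hab : (a, b) ≠ 0) :
    Module.finrank K (LinearMap.ker (twistedForm σ a b).polarBilin) ≤ 2 := by
  have : Module.Finite K F := Module.Finite.of_finite
  set W := LinearMap.ker (twistedForm σ a b).polarBilin with hW
  by_cases hbot : W = ⊥
  · rw [hbot, finrank_bot]; exact Nat.zero_le _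
  obtain ⟨x, hxW, hx⟩ := Submodule.exists_mem_ne_zero_of_ne_bot hbot
  have hxr := (mem_ker_polarBilin_twistedForm σ a b x).1 hxW
  -- For a = 0 the radical equation reads σ(2bx) = 0, which has no nonzero solution when b ≠ 0.
  have ha : a ≠ 0 := by
    rintro rfl
    have hb : b ≠ 0 := by rintro rfl; exact hab rfl
    simp [radicalEquation, hF2, hb, hx] at hxr
  let L : F →ₗ[K] F :=
    { toFun := fun y => a * twistedWronskian σ x y
      map_add' := fun y y' => by simp only [twistedWronskian, map_add]; ring
      map_smul' := fun c y => by
        simp only [twistedWronskian, Algebra.smul_def, map_mul, AlgEquiv.commutes,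
          RingHom.id_apply]; ring }
  have h1 := (L.domRestrict W).finrank_range_add_finrank_ker
  have h2 : Module.finrank K (LinearMap.range (L.domRestrict W)) ≤ 1 := by
    have hle : LinearMap.range (L.domRestrict W) ≤ Submodule.span K {(1 : F)} := by
      rintro _ ⟨⟨y, hy⟩, rfl⟩
      obtain ⟨c, hc⟩ := hσ _ (mul_twistedWronskian_fixed σ hxr
        ((mem_ker_polarBilin_twistedForm σ a b y).1 hy))
      refine Submodule.mem_span_singleton.2 ⟨c, ?_⟩
      rw [Algebra.smul_def, mul_one, hc]; rfl
    exact (Submodule.finrank_mono hle).trans (by rw [finrank_span_singleton one_ne_zero])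
  have h3 : Module.finrank K (LinearMap.ker (L.domRestrict W)) ≤ 1 := by
    refine finrank_le_one (⟨⟨x, hxW⟩, ?_⟩ : LinearMap.ker (L.domRestrict W)) ?_
    · rw [LinearMap.mem_ker]
      change a * twistedWronskian σ x x = 0
      simp [twistedWronskian]
    · rintro ⟨⟨y, hy⟩, hy'⟩
      rw [LinearMap.mem_ker] at hy'
      have h4 : a * twistedWronskian σ x y = 0 := hy'
      obtain ⟨c, hc⟩ := (twistedWronskian_eq_zero_iff σ hσ hx).1
        ((mul_eq_zero.1 h4).resolve_left ha)
      exact ⟨c, Subtype.ext (Subtype.ext hc)⟩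
  omega

variable [DecidableEq F]

theorem card_filter_radicalEquation (hF2 : (2 : F) ≠ 0) (σ : F ≃ₐ[K] F) {x : F} (hx : x ≠ 0) :
    #{ab : F × F | radicalEquation σ ab.1 ab.2 x = 0} = Fintype.card F := by
  rw [← Finset.card_univ]
  refine Finset.card_nbij' (fun ab => ab.1) (fun a => (a, radicalCoefficient σ x a)) ?_ ?_ ?_ ?_
  · intro ab _; simp
  · intro a _; simp [radicalEquation_eq_zero_iff hF2 σ hx]
  · rintro ⟨a, b⟩ h
    simp only [Finset.coe_filter, Finset.mem_univ, true_and, Set.mem_ofPred_eq,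
      radicalEquation_eq_zero_iff hF2 σ hx] at h
    simp [h]
  · intro a _; rfl

/-- The solutions are parametrized by t = aW(x, y), which must lie in K; then a is determined, and b
is determined by a and x. -/
theorem card_filter_radicalEquation_pair (hF2 : (2 : F) ≠ 0) (σ : F ≃ₐ[K] F)
    (hσ : ∀ x, σ x = x → x ∈ Set.range (algebraMap K F)) {x y : F}
    (hxy : twistedWronskian σ x y ≠ 0) :
    #{ab : F × F | radicalEquation σ ab.1 ab.2 x = 0 ∧ radicalEquation σ ab.1 ab.2 y = 0} =
      Fintype.card K := by
  have hx : x ≠ 0 := by rintro rfl; simp [twistedWronskian] at hxy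
  rw [← Finset.card_univ (α := K)]
  symm
  refine Finset.card_bij (fun t _ => (algebraMap K F t / twistedWronskian σ x y,
    radicalCoefficient σ x (algebraMap K F t / twistedWronskian σ x y))) ?_ ?_ ?_
  · intro t _
    have h1 : radicalEquation σ (algebraMap K F t / twistedWronskian σ x y)
        (radicalCoefficient σ x (algebraMap K F t / twistedWronskian σ x y)) x = 0 :=
      (radicalEquation_eq_zero_iff hF2 σ hx _ _).2 rfl
    simp only [Finset.mem_filter, Finset.mem_univ, true_and]
    refine ⟨h1, radicalEquation_of_fixed σ hx h1 ?_⟩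
    rw [div_mul_cancel₀ _ hxy, AlgEquiv.commutes]
  · intro t _ t' _ h
    have h1 := (Prod.ext_iff.1 h).1
    simp only [div_left_inj' hxy] at h1
    exact (algebraMap K F).injective h1
  · rintro ⟨a, b⟩ h
    simp only [Finset.mem_filter, Finset.mem_univ, true_and] at h
    obtain ⟨t, ht⟩ := hσ _ (mul_twistedWronskian_fixed σ h.1 h.2)
    have ha : algebraMap K F t / twistedWronskian σ x y = a := by
      rw [ht, mul_div_cancel_right₀ _ hxy]
    refine ⟨t, Finset.mem_univ _, ?_⟩
    rw [ha, ← (radicalEquation_eq_zero_iff hF2 σ hx _ _).1 h.1]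

/-- This is the number of ordered pairs of linearly independent vectors of W. -/
theorem card_pairs_twistedWronskian_ne_zero (σ : F ≃ₐ[K] F)
    (hσ : ∀ x, σ x = x → x ∈ Set.range (algebraMap K F)) (W : Submodule K F)
    [DecidablePred (· ∈ W)] :
    (#{xy : F × F | (xy.1 ∈ W ∧ xy.2 ∈ W) ∧ twistedWronskian σ xy.1 xy.2 ≠ 0} : ℤ) =
      ((Nat.card W : ℤ) - 1) * ((Nat.card W : ℤ) - Fintype.card K) := by
  have hcW : #{x | x ∈ W} = Nat.card W := by
    rw [Nat.card_eq_fintype_card, Fintype.card_subtype]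
  have hx : ∀ x ∈ W, x ≠ 0 → (#{y | y ∈ W ∧ twistedWronskian σ x y ≠ 0} : ℤ) =
      (Nat.card W : ℤ) - Fintype.card K := by
    intro x hxW hx
    have h1 : #{y | y ∈ W ∧ twistedWronskian σ x y = 0} = Fintype.card K := by
      rw [← Finset.card_univ]
      symm
      refine Finset.card_bij (fun c _ => c • x) ?_ ?_ ?_
      · intro c _
        simp only [Finset.mem_filter, Finset.mem_univ, true_and]
        exact ⟨W.smul_mem c hxW, (twistedWronskian_eq_zero_iff σ hσ hx).2 ⟨c, rfl⟩⟩
      · intro c _ c' _ h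
        exact smul_left_injective K hx h
      · intro y hy
        simp only [Finset.mem_filter, Finset.mem_univ, true_and] at hy
        obtain ⟨c, hc⟩ := (twistedWronskian_eq_zero_iff σ hσ hx).1 hy.2
        exact ⟨c, Finset.mem_univ _, hc⟩
    have h2 := Finset.card_filter_add_card_filter_not (s := ({y | y ∈ W} : Finset F))
      (fun y => twistedWronskian σ x y = 0)
    rw [Finset.filter_filter, Finset.filter_filter, h1, hcW] at h2
    rw [← h2]; push_cast; simp
  have h3 : (#{xy : F × F | (xy.1 ∈ W ∧ xy.2 ∈ W) ∧ twistedWronskian σ xy.1 xy.2 ≠ 0} : ℤ) =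
      ∑ x ∈ ({x | x ∈ W} : Finset F), (#{y | y ∈ W ∧ twistedWronskian σ x y ≠ 0} : ℤ) := by
    rw [Finset.card_filter, Fintype.sum_prod_type, Finset.sum_filter]
    push_cast
    refine Finset.sum_congr rfl fun x _ => ?_
    rw [Finset.card_filter]
    push_cast
    split_ifs with h
    · simp [h]
    · simp [h]
  rw [h3, ← Finset.sum_erase_add _ _ (show (0 : F) ∈ ({x | x ∈ W} : Finset F) by simp)]
  rw [Finset.sum_congr rfl (g := fun _ => (Nat.card W : ℤ) - Fintype.card K)]
  · rw [Finset.sum_const, Finset.card_erase_of_mem (by simp), hcW, nsmul_eq_mul,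
      Nat.cast_sub Nat.card_pos]
    simp [twistedWronskian]
  · intro x hx'
    simp only [Finset.mem_erase, Finset.mem_filter, Finset.mem_univ, true_and] at hx'
    exact hx x hx'.2 hx'.1

end TwistedForms

/-! ### Rank distribution, sign distribution and the enumerator of zeros. -/

section RankDistribution

variable {K : Type*} [Field K] {F : Type*} [Field F] [Algebra K F]

theorem twistedForm_zero_zero (σ : F ≃ₐ[K] F) : twistedForm σ (0 : F) 0 = 0 := by
  ext x; simp [twistedForm_apply]

variable [Fintype K] [Fintype F]

/-- The dimension of the radical of `twistedForm σ a b`. -/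
noncomputable def corank (σ : F ≃ₐ[K] F) (ab : F × F) : ℕ :=
  Module.finrank K (LinearMap.ker (twistedForm σ ab.1 ab.2).polarBilin)

/-- The number of nonzero pairs `(a, b)` for which `twistedForm σ a b` has corank `j`. -/
noncomputable def corankCount (σ : F ≃ₐ[K] F) (j : ℕ) : ℕ :=
  {ab : F × F | ab ≠ 0 ∧ corank σ ab = j}.ncard

theorem natCard_radical (σ : F ≃ₐ[K] F) (ab : F × F) :
    Nat.card (LinearMap.ker (twistedForm σ ab.1 ab.2).polarBilin) =
      Fintype.card K ^ corank σ ab := by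
  have : Module.Finite K F := Module.Finite.of_finite
  rw [Module.natCard_eq_pow_finrank (K := K), Nat.card_eq_fintype_card]; rfl

theorem corank_zero (σ : F ≃ₐ[K] F) : corank σ (0 : F × F) = Module.finrank K F := by
  have : LinearMap.ker (twistedForm σ (0 : F) 0).polarBilin = ⊤ := by
    rw [Submodule.eq_top_iff']
    intro x
    rw [mem_ker_polarBilin_twistedForm]; simp [radicalEquation]
  rw [corank, Prod.fst_zero, Prod.snd_zero, this, finrank_top]

theorem corank_trichotomy (hF2 : (2 : F) ≠ 0) (σ : F ≃ₐ[K] F)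
    (hσ : ∀ x, σ x = x → x ∈ Set.range (algebraMap K F)) {ab : F × F} (hab : ab ≠ 0) :
    corank σ ab = 0 ∨ corank σ ab = 1 ∨ corank σ ab = 2 := by
  have : corank σ ab ≤ 2 := finrank_radical_le_two hF2 σ hσ hab
  omega

theorem sum_eq_of_corank [DecidableEq F] (hF2 : (2 : F) ≠ 0) (σ : F ≃ₐ[K] F)
    (hσ : ∀ x, σ x = x → x ∈ Set.range (algebraMap K F)) (T : F × F → ℚ) (g : ℕ → ℚ)
    (hT : ∀ ab ≠ 0, T ab = g (corank σ ab)) :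
    ∑ ab, T ab = T 0 + corankCount σ 0 * g 0 + corankCount σ 1 * g 1 + corankCount σ 2 * g 2 := by
  have key : ∀ ab : F × F, T ab = (if ab = 0 then T 0 else 0) +
      (if ab ≠ 0 ∧ corank σ ab = 0 then g 0 else 0) +
      (if ab ≠ 0 ∧ corank σ ab = 1 then g 1 else 0) +
      (if ab ≠ 0 ∧ corank σ ab = 2 then g 2 else 0) := by
    intro ab
    by_cases h : ab = 0
    · simp [h]
    · rcases corank_trichotomy hF2 σ hσ h with h' | h' | h' <;> simp [h, h', hT ab h]
  have hc : ∀ j, corankCount σ j = #{ab : F × F | ab ≠ 0 ∧ corank σ ab = j} := by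
    intro j
    rw [corankCount, ← Set.ncard_coe_finset]; simp
  rw [Finset.sum_congr rfl fun ab _ => key ab]
  simp only [Finset.sum_add_distrib, hc]
  simp [← Finset.sum_filter]

/-- Double count of pairs (form, radical vector): x = 0 lies in every radical, and for x ≠ 0 each a
admits exactly one b. -/
theorem sum_card_radical [DecidableEq F] (hF2 : (2 : F) ≠ 0) (σ : F ≃ₐ[K] F) :
    ∑ ab : F × F, (Fintype.card K : ℚ) ^ corank σ ab =
      (Fintype.card F : ℚ) ^ 2 + ((Fintype.card F : ℚ) - 1) * Fintype.card F := by
  have h1 : ∀ ab : F × F, (Fintype.card K : ℚ) ^ corank σ ab =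
      ∑ x : F, if radicalEquation σ ab.1 ab.2 x = 0 then 1 else 0 := by
    intro ab
    have := natCard_radical σ ab
    rw [Nat.card_congr (Equiv.subtypeEquivRight fun x =>
      mem_ker_polarBilin_twistedForm σ ab.1 ab.2 x), Nat.card_eq_fintype_card,
      Fintype.card_subtype, Finset.card_filter] at this
    exact_mod_cast this.symm
  have h2 : ∀ x : F, x ≠ 0 → ∑ ab : F × F,
      (if radicalEquation σ ab.1 ab.2 x = 0 then (1 : ℚ) else 0) = Fintype.card F := by
    intro x hx
    have := card_filter_radicalEquation hF2 σ hx
    rw [Finset.card_filter] at this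
    exact_mod_cast this
  rw [Finset.sum_congr rfl fun ab _ => h1 ab, Finset.sum_comm,
    ← Finset.add_sum_erase _ _ (Finset.mem_univ (0 : F)),
    Finset.sum_congr rfl fun x hx => h2 x (Finset.ne_of_mem_erase hx),
    Finset.sum_const, Finset.card_erase_of_mem (Finset.mem_univ _), Finset.card_univ,
    nsmul_eq_mul, Nat.cast_sub Fintype.card_pos]
  simp [radicalEquation, sq]

/-- Double count of forms with an independent pair in the radical. The summand vanishes in coranks 0
and 1, so among nonzero forms it isolates corank 2. -/
theorem sum_card_radical_pairs [DecidableEq F] (hF2 : (2 : F) ≠ 0) (σ : F ≃ₐ[K] F)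
    (hσ : ∀ x, σ x = x → x ∈ Set.range (algebraMap K F)) :
    ∑ ab : F × F, ((Fintype.card K : ℚ) ^ corank σ ab - 1) *
        ((Fintype.card K : ℚ) ^ corank σ ab - Fintype.card K) =
      ((Fintype.card F : ℚ) - 1) * ((Fintype.card F : ℚ) - Fintype.card K) * Fintype.card K := by
  classical
  have h1 : ∀ ab : F × F, ((Fintype.card K : ℚ) ^ corank σ ab - 1) *
        ((Fintype.card K : ℚ) ^ corank σ ab - Fintype.card K) =
      ∑ xy : F × F, if twistedWronskian σ xy.1 xy.2 ≠ 0 then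
        (if radicalEquation σ ab.1 ab.2 xy.1 = 0 ∧ radicalEquation σ ab.1 ab.2 xy.2 = 0
          then 1 else 0) else 0 := by
    intro ab
    have := card_pairs_twistedWronskian_ne_zero σ hσ
      (LinearMap.ker (twistedForm σ ab.1 ab.2).polarBilin)
    rw [natCard_radical] at this
    simp only [mem_ker_polarBilin_twistedForm] at this
    rw [Finset.card_filter] at this
    have h := congrArg (Int.cast : ℤ → ℚ) this
    push_cast at h
    rw [← h]
    refine Finset.sum_congr rfl fun xy _ => ?_
    by_cases h1 : twistedWronskian σ xy.1 xy.2 = 0 <;> simp [h1]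
  have h2 : ∀ xy : F × F, (∑ ab : F × F, if twistedWronskian σ xy.1 xy.2 ≠ 0 then
        (if radicalEquation σ ab.1 ab.2 xy.1 = 0 ∧ radicalEquation σ ab.1 ab.2 xy.2 = 0
          then (1 : ℚ) else 0) else 0) =
      (if twistedWronskian σ xy.1 xy.2 ≠ 0 then 1 else 0) * Fintype.card K := by
    intro xy
    by_cases hxy : twistedWronskian σ xy.1 xy.2 = 0
    · simp [hxy]
    · have := card_filter_radicalEquation_pair hF2 σ hσ hxy
      rw [Finset.card_filter] at this
      simp only [if_pos (show twistedWronskian σ xy.1 xy.2 ≠ 0 from hxy), one_mul]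
      exact_mod_cast this
  have h3 := card_pairs_twistedWronskian_ne_zero σ hσ (⊤ : Submodule K F)
  rw [Nat.card_congr (Submodule.topEquiv (R := K) (M := F)).toEquiv,
    Nat.card_eq_fintype_card] at h3
  simp only [Submodule.mem_top, true_and] at h3
  rw [Finset.card_filter] at h3
  have h3 := congrArg (Int.cast : ℤ → ℚ) h3
  push_cast at h3
  rw [Finset.sum_congr rfl fun ab _ => h1 ab, Finset.sum_comm,
    Finset.sum_congr rfl fun xy _ => h2 xy, ← Finset.sum_mul, h3]

variable {m : ℕ}

theorem finrank_eq_of_card (hF : Fintype.card F = Fintype.card K ^ m) :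
    Module.finrank K F = m := by
  rw [Module.card_eq_pow_finrank (K := K) (V := F)] at hF
  exact Nat.pow_right_injective Fintype.one_lt_card hF

/-- The numbers of forms of each corank. -/
theorem corankCount_eq (hF2 : (2 : F) ≠ 0) (σ : F ≃ₐ[K] F)
    (hσ : ∀ x, σ x = x → x ∈ Set.range (algebraMap K F)) {q s : ℚ}
    (hq : (Fintype.card K : ℚ) = q) (hs : (Fintype.card F : ℚ) = q * s ^ 2) :
    (corankCount σ 2 : ℚ) = (q * s ^ 2 - 1) * (s ^ 2 - 1) / (q ^ 2 - 1) ∧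
    (corankCount σ 1 : ℚ) = (q * s ^ 2 - 1) * s ^ 2 ∧
    (corankCount σ 0 : ℚ) = (q * s ^ 2) ^ 2 - 1 - (q * s ^ 2 - 1) * s ^ 2 -
      (q * s ^ 2 - 1) * (s ^ 2 - 1) / (q ^ 2 - 1) := by
  classical
  have hq1 : 1 < q := by rw [← hq]; exact_mod_cast Fintype.one_lt_card
  have hcard : (Fintype.card K : ℚ) ^ Module.finrank K F = q * s ^ 2 := by
    rw [← hs, Module.card_eq_pow_finrank (K := K) (V := F)]; push_cast; rfl
  have e1 := sum_eq_of_corank hF2 σ hσ (fun _ => 1) (fun _ => 1) (fun _ _ => rfl)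
  have e2 := sum_eq_of_corank hF2 σ hσ _ (fun e => (Fintype.card K : ℚ) ^ e) (fun _ _ => rfl)
  have e3 := sum_eq_of_corank hF2 σ hσ _ (fun e => ((Fintype.card K : ℚ) ^ e - 1) *
    ((Fintype.card K : ℚ) ^ e - Fintype.card K)) (fun _ _ => rfl)
  rw [sum_card_radical hF2 σ] at e2
  rw [sum_card_radical_pairs hF2 σ hσ] at e3
  simp only [corank_zero, hcard, hs] at e2 e3
  simp only [Finset.sum_const, Finset.card_univ, Fintype.card_prod, nsmul_eq_mul, mul_one,
    Nat.cast_mul, hs] at e1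
  rw [hq] at e2 e3
  simp only [pow_zero, pow_one, sub_self, zero_mul, mul_zero, add_zero, mul_one] at e1 e2 e3
  have hq2 : q ^ 2 - 1 ≠ 0 := by nlinarith
  -- The pair count involves only the zero form and corank 2. Subtracting the number of forms from
  -- the vector count then eliminates corank 0 and gives corank 1.
  have h2 : (corankCount σ 2 : ℚ) = (q * s ^ 2 - 1) * (s ^ 2 - 1) / (q ^ 2 - 1) := by
    rw [eq_div_iff hq2]
    have h0 : q * (q - 1) ≠ 0 := by nlinarith
    apply mul_left_cancel₀ h0
    linear_combination -e3
  have h1 : (corankCount σ 1 : ℚ) = (q * s ^ 2 - 1) * s ^ 2 := by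
    have h0 : q - 1 ≠ 0 := by linarith
    apply mul_left_cancel₀ h0
    rw [eq_div_iff hq2] at h2
    linear_combination e1 - e2 - h2
  refine ⟨h2, h1, ?_⟩
  rw [← h2, ← h1]
  linear_combination -e1

/-- For fixed x ≠ 0, translating b by multiples of z/x² with Tr z = 1 makes the value at x uniform,
so a fraction 1/q of the pairs (a, b) vanish there. -/
theorem sum_card_zeros_twistedForm [DecidableEq K] [DecidableEq F] (σ : F ≃ₐ[K] F) :
    ∑ ab : F × F, ((Fintype.card K * #{x | twistedForm σ ab.1 ab.2 x = 0} : ℕ) : ℚ) =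
      Fintype.card K * (Fintype.card F : ℚ) ^ 2 +
        ((Fintype.card F : ℚ) - 1) * (Fintype.card F : ℚ) ^ 2 := by
  have h2 : ∀ x : F, x ≠ 0 →
      Fintype.card K * #{ab : F × F | twistedForm σ ab.1 ab.2 x = 0} = Fintype.card F ^ 2 := by
    intro x hx
    obtain ⟨z, hz⟩ := Algebra.trace_surjective K F 1
    rw [card_mul_card_zeros_of_translate (V := F × F) (fun ab => twistedForm σ ab.1 ab.2 x)
      (0, z / (x * x)) (c := (1 : K)) one_ne_zero, Fintype.card_prod, sq]
    intro ab s
    simp only [twistedForm_apply, Prod.fst_add, Prod.snd_add, Prod.smul_mk, smul_zero, add_zero,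
      mul_one]
    have hs : s = Algebra.trace K F (s • z) := by rw [map_smul, hz, smul_eq_mul, mul_one]
    conv_rhs => rw [hs, ← map_add]
    congr 1
    simp only [Algebra.smul_def]; field_simp; ring
  have h3 : ∀ x : F, x ≠ 0 → ∑ ab : F × F, (Fintype.card K : ℚ) *
      (if twistedForm σ ab.1 ab.2 x = 0 then (1 : ℚ) else 0) = (Fintype.card F : ℚ) ^ 2 := by
    intro x hx
    have := h2 x hx
    rw [Finset.card_filter] at this
    rw [← Finset.mul_sum]
    exact_mod_cast this
  have h1 : ∀ ab : F × F, ((Fintype.card K * #{x | twistedForm σ ab.1 ab.2 x = 0} : ℕ) : ℚ) =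
      ∑ x : F, (Fintype.card K : ℚ) *
        (if twistedForm σ ab.1 ab.2 x = 0 then (1 : ℚ) else 0) := by
    intro ab
    rw [Finset.card_filter, ← Finset.mul_sum]
    push_cast; rfl
  rw [Finset.sum_congr rfl fun ab _ => h1 ab, Finset.sum_comm,
    ← Finset.add_sum_erase _ _ (Finset.mem_univ (0 : F)),
    Finset.sum_congr rfl fun x hx => h3 x (Finset.ne_of_mem_erase hx),
    Finset.sum_const, Finset.card_erase_of_mem (Finset.mem_univ _), Finset.card_univ,
    nsmul_eq_mul, Nat.cast_sub Fintype.card_pos]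
  simp [sq]; ring

/-- The enumerator of the numbers of zeros of the functions
`x ↦ Tr (a σ(x) x + b x ^ 2) + φ(x) + h`. -/
theorem sum_zeros_twistedForm [DecidableEq K] [DecidableEq F] (hK : ringChar K ≠ 2)
    (hF2 : (2 : F) ≠ 0) (σ : F ≃ₐ[K] F)
    (hσ : ∀ x, σ x = x → x ∈ Set.range (algebraMap K F)) {q k : ℕ} (hk : 1 ≤ k)
    (hq : Fintype.card K = q) (hF : Fintype.card F = q ^ (2 * k + 1))
    [Fintype (Module.Dual K F)] (G : ℤ → ℚ) {Q s : ℚ} (hQ : (q : ℚ) = Q) (hs : (q : ℚ) ^ k = s) :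
    ∑ ab : F × F, ∑ φ : Module.Dual K F, ∑ h : K,
        G ((q : ℤ) * #{x | twistedForm σ ab.1 ab.2 x + φ x + h = 0}) =
      ((Q * s ^ 2 - 1) * Q * G (q ^ (2 * k + 1)) +
        (G (q * q ^ (2 * k + 1)) + (Q - 1) * G 0)) +
      ((Q * s ^ 2) ^ 2 - 1 - (Q * s ^ 2 - 1) * s ^ 2 -
          (Q * s ^ 2 - 1) * (s ^ 2 - 1) / (Q ^ 2 - 1)) *
        (Q * s ^ 2 * (G (q ^ (2 * k + 1)) + (Q - 1) / 2 *
          (G (q ^ (2 * k + 1) + q ^ (k + 1)) + G (q ^ (2 * k + 1) - q ^ (k + 1))))) +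
      (Q * s ^ 2 - 1) * s * (s + 1) / 2 *
        ((Q * s ^ 2 - s ^ 2) * Q * G (q ^ (2 * k + 1)) +
          s ^ 2 * (G (q ^ (2 * k + 1) + (q - 1) * q ^ (k + 1)) +
            (Q - 1) * G (q ^ (2 * k + 1) - q ^ (k + 1)))) +
      (Q * s ^ 2 - 1) * s * (s - 1) / 2 *
        ((Q * s ^ 2 - s ^ 2) * Q * G (q ^ (2 * k + 1)) +
          s ^ 2 * (G (q ^ (2 * k + 1) - (q - 1) * q ^ (k + 1)) +
            (Q - 1) * G (q ^ (2 * k + 1) + q ^ (k + 1)))) +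
      (Q * s ^ 2 - 1) * (s ^ 2 - 1) / (Q ^ 2 - 1) *
        ((Q * s ^ 2 - s ^ 2 / Q) * Q * G (q ^ (2 * k + 1)) +
          s ^ 2 / Q * (G (q ^ (2 * k + 1)) + (Q - 1) / 2 *
          (G (q ^ (2 * k + 1) + q ^ (k + 2)) + G (q ^ (2 * k + 1) - q ^ (k + 2))))) := by
  have hq1 : 1 < q := hq ▸ Fintype.one_lt_card
  have hQ1 : 1 < Q := by rw [← hQ]; exact_mod_cast hq1
  have hQ0 : Q ≠ 0 := by linarith
  have hs0 : s ≠ 0 := by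
    rw [← hs, hQ]; exact pow_ne_zero _ hQ0
  have hn : Fintype.card F = Fintype.card K ^ (2 * k + 1) := by rw [hq, hF]
  have hFQ : (Fintype.card F : ℚ) = Q * s ^ 2 := by
    rw [hF, ← hs, ← hQ]; push_cast; ring
  have p1 : Q ^ (2 * k + 1) = Q * s ^ 2 := by rw [← hs, ← hQ]; ring
  have p2 : Q ^ (2 * k) = s ^ 2 := by rw [← hs, ← hQ]; ring
  have p3 : Q ^ (2 * k - 1) = s ^ 2 / Q := by
    rw [eq_div_iff hQ0, ← p2, ← pow_succ]; congr 1; omega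
  have d0 : 2 * k + 1 - (2 * k + 1) / 2 = k + 1 := by omega
  have d1 : 2 * k + 1 - (2 * k) / 2 = k + 1 := by omega
  have d2 : 2 * k + 1 - (2 * k - 1) / 2 = k + 2 := by omega
  set T : F × F → ℚ := fun ab => ∑ φ : Module.Dual K F, ∑ h : K,
        G ((q : ℤ) * #{x | twistedForm σ ab.1 ab.2 x + φ x + h = 0}) with hT
  set X : ℚ := (Q - 1) * (Q * s) with hX
  have hX0 : X ≠ 0 := mul_ne_zero (by linarith) (mul_ne_zero hQ0 hs0)
  -- The normalized excess of zeros: the sign ε in corank 1, zero for odd rank, and s for the zero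
  -- form.
  set E : F × F → ℚ := fun ab =>
    (((q * #{x | twistedForm σ ab.1 ab.2 x = 0} : ℕ) : ℚ) - Q * s ^ 2) / X with hE
  set B : ℤ → ℚ := fun ε => (Q * s ^ 2 - s ^ 2) * Q * G (q ^ (2 * k + 1)) +
          s ^ 2 * (G (q ^ (2 * k + 1) + ε * ((q - 1) * q ^ (k + 1))) +
            (Q - 1) * G (q ^ (2 * k + 1) - ε * q ^ (k + 1))) with hB
  -- the zero form
  have t0 : T 0 = (Q * s ^ 2 - 1) * Q * G (q ^ (2 * k + 1)) +
        (G (q * q ^ (2 * k + 1)) + (Q - 1) * G 0) := by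
    have hr := natCard_radical σ (0 : F × F)
    rw [corank_zero, finrank_eq_of_card hn] at hr
    obtain ⟨ε, hε, h0, h⟩ := exists_sign_sum_zeros_of_even_rank hK
      (twistedForm σ (0 : F × F).1 (0 : F × F).2) hn (zero_add _) Even.zero hr
    have h := h G
    rw [hq] at h h0
    -- The zero form is handled as rank 0; the sign -1 would contradict that it vanishes everywhere.
    have hε1 : ε = 1 := by
      have hq0 : (0 : ℤ) < q := by exact_mod_cast (by omega : 0 < q)
      simp only [Prod.fst_zero, Prod.snd_zero, twistedForm_zero_zero, zero_apply,
        Finset.filter_true, Finset.card_univ, hF] at h0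
      rcases hε with h | h
      · exact h
      · exfalso
        rw [h] at h0
        have : (0 : ℤ) < q ^ (2 * k + 1) := by positivity
        push_cast at h0
        have hq2 : (1 : ℤ) < q := by exact_mod_cast hq1
        nlinarith
    simp only [hT]
    rw [h, hε1, hQ, p1]
    simp only [Nat.zero_div, Nat.sub_zero, pow_zero]
    have a1 : (q : ℤ) ^ (2 * k + 1) + 1 * (((q : ℤ) - 1) * (q : ℤ) ^ (2 * k + 1)) =
      q * q ^ (2 * k + 1) := by ring
    have a2 : (q : ℤ) ^ (2 * k + 1) - 1 * (q : ℤ) ^ (2 * k + 1) = 0 := by ring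
    rw [a1, a2]; ring
  have e0 : E 0 = s / Q * Q := by
    simp only [hE, Prod.fst_zero, Prod.snd_zero, twistedForm_zero_zero, zero_apply,
        Finset.filter_true, Finset.card_univ, Nat.cast_mul, hFQ, hX, hQ]
    have : Q - 1 ≠ 0 := by linarith
    field_simp
  -- forms of odd rank
  have odd_E : ∀ (ab : F × F) (r e : ℕ), r + e = 2 * k + 1 → Odd r → corank σ ab = e →
      E ab = 0 := by
    intro ab r e hre hr he
    have hc := natCard_radical σ ab
    rw [he] at hc
    obtain ⟨ε, hε, h⟩ := exists_sign_card_quadraticForm hK _ hn hre hc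
    have h := h 0
    rw [if_neg (Nat.not_even_iff_odd.2 hr), MulChar.map_zero, mul_zero, add_zero, hq] at h
    have h' := congrArg (Int.cast : ℤ → ℚ) h
    push_cast at h'
    simp only [hE]
    push_cast
    rw [h', hQ, p1, sub_self, zero_div]
  have T0 : ∀ ab, corank σ ab = 0 → T ab = Q * s ^ 2 * (G (q ^ (2 * k + 1)) + (Q - 1) / 2 *
          (G (q ^ (2 * k + 1) + q ^ (k + 1)) + G (q ^ (2 * k + 1) - q ^ (k + 1)))) := by
    intro ab he
    have hc := natCard_radical σ ab
    rw [he] at hc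
    have h := sum_zeros_of_odd_rank hK _ hn (add_zero _) ⟨k, rfl⟩ hc G
    rw [hq, d0, hQ, p1] at h
    simp only [hT]
    rw [h]; ring
  have T2 : ∀ ab, corank σ ab = 2 → T ab =
        (Q * s ^ 2 - s ^ 2 / Q) * Q * G (q ^ (2 * k + 1)) +
          s ^ 2 / Q * (G (q ^ (2 * k + 1)) + (Q - 1) / 2 *
          (G (q ^ (2 * k + 1) + q ^ (k + 2)) + G (q ^ (2 * k + 1) - q ^ (k + 2)))) := by
    intro ab he
    have hc := natCard_radical σ ab
    rw [he] at hc
    have h := sum_zeros_of_odd_rank hK _ hn (r := 2 * k - 1) (by omega) ⟨k - 1, by omega⟩ hc G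
    rw [hq, d2, hQ, p1, p3] at h
    simp only [hT]
    rw [h]
  have T1 : ∀ ab, corank σ ab = 1 → T ab = (1 + E ab) / 2 * B 1 + (1 - E ab) / 2 * B (-1) := by
    intro ab he
    have hc := natCard_radical σ ab
    rw [he] at hc
    obtain ⟨ε, hε, h0, h⟩ := exists_sign_sum_zeros_of_even_rank hK _ hn (r := 2 * k) rfl
      (even_two_mul k) hc
    have h := h G
    rw [hq, d1, hQ, p1, p2] at h
    have hEε : E ab = ε := by
      rw [hq, d1] at h0
      have h' := congrArg (Int.cast : ℤ → ℚ) h0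
      push_cast at h'
      simp only [hE]
      push_cast
      rw [h', hQ, p1, hX, pow_succ Q k, ← hQ, hs, hQ]
      have : Q - 1 ≠ 0 := by linarith
      field_simp; ring
    have hTB : T ab = B ε := by
      simp only [hT, hB]
      rw [h]
    rw [hEε, hTB]
    rcases hε with rfl | rfl <;> push_cast <;> ring
  -- summation
  have hEsum : ∑ ab, E ab = s / Q * Q + s * (Q * s ^ 2 - 1) := by
    have h := sum_card_zeros_twistedForm (K := K) σ
    rw [hFQ, hq, hQ] at h
    simp only [hE]
    rw [← Finset.sum_div, Finset.sum_sub_distrib, h]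
    simp only [Finset.sum_const, Finset.card_univ, Fintype.card_prod, nsmul_eq_mul,
      Nat.cast_mul, hFQ, hX]
    have : Q - 1 ≠ 0 := by linarith
    field_simp; ring
  obtain ⟨c2, c1, c0⟩ := corankCount_eq hF2 σ hσ (q := Q) (s := s) (by rw [hq, hQ]) hFQ
  -- In corank 1, `T` is affine in the sign `E`. Subtracting its linear part leaves a quantity
  -- depending on the corank alone for nonzero forms, and `hEsum` accounts for what was subtracted.
  have hmain := sum_eq_of_corank hF2 σ hσ
    (fun ab => T ab - E ab * ((B 1 - B (-1)) / 2))
    (fun e => if e = 0 then Q * s ^ 2 * (G (q ^ (2 * k + 1)) + (Q - 1) / 2 *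
          (G (q ^ (2 * k + 1) + q ^ (k + 1)) + G (q ^ (2 * k + 1) - q ^ (k + 1)))) else
      if e = 1 then (B 1 + B (-1)) / 2 else
        (Q * s ^ 2 - s ^ 2 / Q) * Q * G (q ^ (2 * k + 1)) +
          s ^ 2 / Q * (G (q ^ (2 * k + 1)) + (Q - 1) / 2 *
          (G (q ^ (2 * k + 1) + q ^ (k + 2)) + G (q ^ (2 * k + 1) - q ^ (k + 2))))) (by
      intro ab hab
      rcases corank_trichotomy hF2 σ hσ hab with h | h | h
      · rw [T0 ab h, odd_E ab (2 * k + 1) 0 rfl ⟨k, rfl⟩ h, h]; simp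
      · rw [T1 ab h, h]; simp; ring
      · rw [T2 ab h, odd_E ab (2 * k - 1) 2 (by omega) ⟨k - 1, by omega⟩ h, h]; simp)
  rw [Finset.sum_sub_distrib, ← Finset.sum_mul, hEsum, t0, e0, c0, c1, c2] at hmain
  simp only [if_true, one_ne_zero, if_false, OfNat.ofNat_ne_zero, OfNat.ofNat_ne_one] at hmain
  have b1 : B 1 = (Q * s ^ 2 - s ^ 2) * Q * G (q ^ (2 * k + 1)) +
          s ^ 2 * (G (q ^ (2 * k + 1) + (q - 1) * q ^ (k + 1)) +
            (Q - 1) * G (q ^ (2 * k + 1) - q ^ (k + 1))) := by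
    simp only [hB, one_mul]
  have b2 : B (-1) = (Q * s ^ 2 - s ^ 2) * Q * G (q ^ (2 * k + 1)) +
          s ^ 2 * (G (q ^ (2 * k + 1) - (q - 1) * q ^ (k + 1)) +
            (Q - 1) * G (q ^ (2 * k + 1) + q ^ (k + 1))) := by
    simp only [hB, neg_mul, one_mul, sub_neg_eq_add, ← sub_eq_add_neg]
  rw [← b1, ← b2]
  linear_combination hmain

end RankDistribution

/-! ### Blocks from supports: multiplicities, automorphisms, double counting. -/

section SupportDesigns

variable {P : Type*} [Fintype P]

/-- Double counting of the flags of a family of `k`-sets with constant pair degree. -/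
theorem ncard_mul_of_pair_regular [DecidableEq P] {Bl : Set (Finset P)} {k lam : ℕ}
    (hk : ∀ B ∈ Bl, B.card = k)
    (hT : ∀ T : Finset P, T.card = 2 → {B ∈ Bl | T ⊆ B}.ncard = lam) :
    Bl.ncard * (k * k - k) = (Fintype.card P * Fintype.card P - Fintype.card P) * lam := by
  classical
  have h1 : ∀ xy ∈ (univ : Finset P).offDiag, #{B ∈ Bl.toFinset | xy ∈ B.offDiag} = lam := by
    rintro ⟨x, y⟩ hxy
    have hne : x ≠ y := by simpa using hxy
    rw [← hT {x, y} (Finset.card_pair hne), ← Set.ncard_coe_finset]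
    congr 1
    ext B
    simp [Finset.insert_subset_iff, hne]
  have h2 : ∀ B ∈ Bl.toFinset, #{xy ∈ (univ : Finset P).offDiag | xy ∈ B.offDiag} = k * k - k := by
    intro B hB
    rw [← hk B (by simpa using hB), ← Finset.offDiag_card]
    congr 1
    ext ⟨x, y⟩
    simp only [Finset.mem_filter, Finset.mem_offDiag, Finset.mem_univ, true_and]
    tauto
  have h3 := Finset.sum_card_bipartiteAbove_eq_sum_card_bipartiteBelow
    (s := Bl.toFinset) (t := (univ : Finset P).offDiag) (fun B xy => xy ∈ B.offDiag)
  simp only [Finset.bipartiteAbove, Finset.bipartiteBelow] at h3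
  rw [Finset.sum_congr rfl h2, Finset.sum_congr rfl h1, Finset.sum_const, Finset.sum_const,
    Finset.offDiag_card, Finset.card_univ, smul_eq_mul, smul_eq_mul] at h3
  rw [Set.ncard_eq_toFinset_card', h3]

variable {p : ℕ}

theorem card_wordSupport (f : P → ZMod p) : (wordSupport f).card = hammingNorm f := by
  rfl

theorem card_zeros_add_hammingNorm (f : P → ZMod p) :
    #{x | f x = 0} + hammingNorm f = Fintype.card P := by
  rw [← Finset.card_univ, ← Finset.card_filter_add_card_filter_not (s := univ) (fun x => f x = 0)]
  rfl

theorem mem_wordSupport (f : P → ZMod p) (x : P) : x ∈ wordSupport f ↔ f x ≠ 0 := by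
  simp [wordSupport]

variable [Fact p.Prime]

theorem wordSupport_smul {c : ZMod p} (hc : c ≠ 0) (f : P → ZMod p) :
    wordSupport (c • f) = wordSupport f := by
  ext x; simp [mem_wordSupport, hc]

/-- If words of weight `i` are determined by their supports up to scalars, each support comes from
exactly `p - 1` words. -/
theorem card_supportBlocks (C : Submodule (ZMod p) (P → ZMod p)) {i : ℕ} (hi : 0 < i)
    (hC : ∀ f ∈ C, ∀ g ∈ C, hammingNorm f = i → wordSupport f = wordSupport g →
      ∃ c : ZMod p, f = c • g) :
    (p - 1) * (supportBlocks C i).ncard = weightCount C i := by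
  classical
  set W : Finset (P → ZMod p) := {f | f ∈ C ∧ hammingNorm f = i} with hW
  have h1 : weightCount C i = W.card := by
    rw [weightCount, ← Set.ncard_coe_finset]; simp [hW]
  have h2 : supportBlocks C i = (W.image wordSupport : Finset (Finset P)) := by
    ext B; simp [supportBlocks, hW, and_assoc]
  rw [h1, h2, Set.ncard_coe_finset, mul_comm]
  rw [Finset.card_eq_sum_card_image wordSupport W]
  symm
  refine Finset.sum_const_nat fun B hB => ?_
  obtain ⟨f, hf, rfl⟩ := Finset.mem_image.1 hB
  simp only [hW, Finset.mem_filter, Finset.mem_univ, true_and] at hf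
  have hf0 : f ≠ 0 := by
    rintro rfl
    rw [hammingNorm_zero] at hf
    omega
  have h3 : ({g ∈ W | wordSupport g = wordSupport f} : Finset (P → ZMod p)) =
      (univ.erase (0 : ZMod p)).image (fun c => c • f) := by
    ext g
    simp only [hW, Finset.mem_filter, Finset.mem_univ, true_and, Finset.mem_image,
      Finset.mem_erase, and_true]
    constructor
    · rintro ⟨⟨hgC, hgi⟩, hg⟩
      obtain ⟨c, hc⟩ := hC g hgC f hf.1 hgi hg
      refine ⟨c, ?_, hc.symm⟩
      rintro rfl
      rw [hc, zero_smul, hammingNorm_zero] at hgi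
      omega
    · rintro ⟨c, hc, rfl⟩
      refine ⟨⟨C.smul_mem c hf.1, ?_⟩, wordSupport_smul hc f⟩
      rw [← card_wordSupport, wordSupport_smul hc f, card_wordSupport, hf.2]
  rw [h3, Finset.card_image_of_injective _ (smul_left_injective _ hf0),
    Finset.card_erase_of_mem (Finset.mem_univ _), Finset.card_univ, ZMod.card]

/-- Two words with the same support agree, up to a scalar, on many coordinates. -/
theorem exists_smul_card_zeros (f g : P → ZMod p) {i : ℕ} (hf : hammingNorm f = i)
    (hfg : wordSupport f = wordSupport g) :
    ∃ c : ZMod p, (p - 1) * (Fintype.card P - i) + i ≤ (p - 1) * #{x | (f - c • g) x = 0} := by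
  classical
  have hp : 1 < p := (Fact.out : p.Prime).one_lt
  have hS : (wordSupport f).card = i := hf
  have hne : ((univ : Finset (ZMod p)).erase 0).Nonempty := ⟨1, by simp⟩
  have hcard : #((univ : Finset (ZMod p)).erase 0) = p - 1 := by
    rw [Finset.card_erase_of_mem (Finset.mem_univ _), Finset.card_univ, ZMod.card]
  have hmaps : ∀ x ∈ wordSupport f, f x / g x ∈ (univ : Finset (ZMod p)).erase 0 := by
    intro x hx
    have hgx : g x ≠ 0 := (mem_wordSupport g x).1 (hfg ▸ hx)
    simp [(mem_wordSupport f x).1 hx, hgx]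
  have hsum := Finset.card_eq_sum_card_fiberwise hmaps
  -- Pigeonhole over the p - 1 nonzero ratios f(x)/g(x); the common zeros of f and g are added
  -- afterwards.
  obtain ⟨c, hc, hle⟩ := Finset.exists_le_of_sum_le hne
    (f := fun _ => i) (g := fun c => (p - 1) * #{x ∈ wordSupport f | f x / g x = c}) (by
      rw [Finset.sum_const, hcard, ← Finset.mul_sum, ← hsum, hS, smul_eq_mul])
  refine ⟨c, ?_⟩
  have hz : #{x | f x = 0} + #{x ∈ wordSupport f | f x / g x = c} ≤
      #{x | (f - c • g) x = 0} := by
    rw [← Finset.card_union_of_disjoint]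
    · refine Finset.card_le_card fun x hx => ?_
      simp only [Finset.mem_union, Finset.mem_filter, Finset.mem_univ, true_and, Pi.sub_apply,
        Pi.smul_apply, smul_eq_mul] at hx ⊢
      rcases hx with hx | ⟨hx, hc⟩
      · have : g x = 0 := by
          by_contra hg
          exact (mem_wordSupport f x).1 (hfg ▸ (mem_wordSupport g x).2 hg) hx
        rw [hx, this]; simp
      · have hgx : g x ≠ 0 := (mem_wordSupport g x).1 (hfg ▸ hx)
        rw [← hc]; field_simp; simp
    · rw [Finset.disjoint_left]
      intro x hx hx'
      simp only [Finset.mem_filter, Finset.mem_univ, true_and, mem_wordSupport] at hx hx'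
      exact hx'.1 hx
  have hzf := card_zeros_add_hammingNorm f
  rw [hf] at hzf
  have hzf' : Fintype.card P - i = #{x | f x = 0} := by omega
  rw [hzf']
  calc (p - 1) * #{x | f x = 0} + i ≤
      (p - 1) * #{x | f x = 0} + (p - 1) * #{x ∈ wordSupport f | f x / g x = c} := by
        gcongr
    _ = (p - 1) * (#{x | f x = 0} + #{x ∈ wordSupport f | f x / g x = c}) := by ring
    _ ≤ _ := by gcongr

theorem wordSupport_comp_equiv (τ : P ≃ P) (f : P → ZMod p) :
    wordSupport (f ∘ τ) = (wordSupport f).map τ.symm.toEmbedding := by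
  ext x
  simp [mem_wordSupport, Finset.mem_map_equiv]

/-- Permutation automorphisms of a code act on the supports of its words of weight `i`. -/
theorem ncard_supportBlocks_map (C : Submodule (ZMod p) (P → ZMod p)) (i : ℕ) (τ : P ≃ P)
    (hτ : ∀ f, f ∈ C ↔ f ∘ τ ∈ C) (T : Finset P) :
    {B ∈ supportBlocks C i | T.map τ.toEmbedding ⊆ B}.ncard =
      {B ∈ supportBlocks C i | T ⊆ B}.ncard := by
  have hB : ∀ B : Finset P, B ∈ supportBlocks C i ↔
      B.map τ.symm.toEmbedding ∈ supportBlocks C i := by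
    intro B
    constructor
    · rintro ⟨f, hf, hfi, rfl⟩
      refine ⟨f ∘ τ, (hτ f).1 hf, ?_, wordSupport_comp_equiv τ f⟩
      rw [← card_wordSupport, wordSupport_comp_equiv, Finset.card_map, card_wordSupport, hfi]
    · rintro ⟨f, hf, hfi, h⟩
      refine ⟨f ∘ τ.symm, (hτ _).2 ?_, ?_, ?_⟩
      · convert hf using 1
        ext x; simp
      · rw [← card_wordSupport, wordSupport_comp_equiv, Finset.card_map, card_wordSupport, hfi]
      · rw [wordSupport_comp_equiv, h]
        ext x; simp [Finset.mem_map_equiv]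
  refine Set.ncard_congr (fun B _ => B.map τ.symm.toEmbedding) ?_ ?_ ?_
  · rintro B ⟨hBC, hT⟩
    refine ⟨(hB B).1 hBC, fun x hx => ?_⟩
    rw [Finset.mem_map_equiv]
    exact hT (Finset.mem_map_of_mem _ hx)
  · intro B B' _ _ h
    exact Finset.map_injective _ h
  · rintro B ⟨hBC, hT⟩
    refine ⟨B.map τ.toEmbedding, ⟨(hB _).2 ?_, Finset.map_subset_map.2 hT⟩, ?_⟩
    · convert hBC using 1
      ext x; simp [Finset.mem_map_equiv]
    · ext x; simp [Finset.mem_map_equiv]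

end SupportDesigns

/-! ### The trace code: parametrization, enumerator, affine invariance. -/

section TraceCode

variable (p l : ℕ) [Fact p.Prime] (F : Type*) [Field F] [Fintype F] [Algebra (ZMod p) F]

/-- The `l`-th power of the Frobenius automorphism. -/
noncomputable def frobeniusPow : F ≃ₐ[ZMod p] F :=
  (FiniteField.frobeniusAlgEquivOfAlgebraic (ZMod p) F) ^ l

theorem frobeniusPow_apply (x : F) : frobeniusPow p l F x = x ^ p ^ l := by
  rw [frobeniusPow, AlgEquiv.coe_pow, FiniteField.coe_frobeniusAlgEquivOfAlgebraic_iterate,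
    ZMod.card]

/-- Such an x is periodic under Frobenius with periods l and m, hence with period gcd(m, l) = 1, so
it lies in the prime field. -/
theorem mem_range_of_frobeniusPow_eq {m : ℕ} (hml : Nat.gcd m l = 1)
    (hF : Fintype.card F = p ^ m) (x : F) (hx : frobeniusPow p l F x = x) :
    x ∈ Set.range (algebraMap (ZMod p) F) := by
  set φ := FiniteField.frobeniusAlgEquivOfAlgebraic (ZMod p) F
  have h1 : Function.IsPeriodicPt φ l x := by
    rw [frobeniusPow, AlgEquiv.coe_pow] at hx; exact hx
  have h2 : Function.IsPeriodicPt φ m x := by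
    change φ^[m] x = x
    rw [FiniteField.coe_frobeniusAlgEquivOfAlgebraic_iterate, ZMod.card, ← hF]
    exact FiniteField.pow_card x
  have h3 := h2.gcd h1
  rw [hml] at h3
  have h4 : φ^[1] x = x := h3
  rw [FiniteField.coe_frobeniusAlgEquivOfAlgebraic_iterate, ZMod.card, pow_one] at h4
  have : CharP F p := charP_of_injective_algebraMap (algebraMap (ZMod p) F).injective p
  have h5 := (Subfield.mem_bot_iff_pow_eq_self (F := F) (p := p)).2 h4
  have h6 : (⊥ : Subfield F) ≤ (algebraMap (ZMod p) F).fieldRange := bot_le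
  exact h6 h5

/-- The parametrization of the trace code. -/
noncomputable def traceWord : ((F × F) × F × ZMod p) →ₗ[ZMod p] (F → ZMod p) where
  toFun u x := Algebra.trace (ZMod p) F (u.1.1 * x ^ (p ^ l + 1) + u.1.2 * x ^ 2 + u.2.1 * x)
    + u.2.2
  map_add' u v := by
    funext x
    simp only [Prod.fst_add, Prod.snd_add, Pi.add_apply, add_mul, map_add]
    ring
  map_smul' r u := by
    funext x
    simp only [Prod.smul_fst, Prod.smul_snd, Pi.smul_apply, smul_mul_assoc, ← smul_add, map_smul,
      smul_eq_mul, mul_add, RingHom.id_apply]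

theorem mem_traceCode_iff (f : F → ZMod p) :
    f ∈ traceCode p l F ↔ ∃ u, traceWord p l F u = f := by
  constructor
  · rintro ⟨a, b, c, h, rfl⟩
    exact ⟨((a, b), c, h), rfl⟩
  · rintro ⟨u, rfl⟩
    exact ⟨u.1.1, u.1.2, u.2.1, u.2.2, rfl⟩

theorem traceWord_apply_eq (u : (F × F) × F × ZMod p) (x : F) :
    traceWord p l F u x = twistedForm (frobeniusPow p l F) u.1.1 u.1.2 x +
      Algebra.traceForm (ZMod p) F u.2.1 x + u.2.2 := by
  rw [twistedForm_apply, Algebra.traceForm_apply, frobeniusPow_apply, ← map_add]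
  change Algebra.trace (ZMod p) F _ + _ = _
  congr 2
  ring

/-- By nondegeneracy of the trace form, c ↦ Tr(c·) runs over all linear functionals exactly once. -/
theorem sum_zeros_traceWord [DecidableEq F] (hp : p ≠ 2) {k : ℕ} (hk : 1 ≤ k)
    (hml : Nat.gcd (2 * k + 1) l = 1) (hF : Fintype.card F = p ^ (2 * k + 1)) (G : ℤ → ℚ)
    {Q s : ℚ} (hQ : (p : ℚ) = Q) (hs : (p : ℚ) ^ k = s) :
    ∑ u, G ((p : ℤ) * #{x | traceWord p l F u x = 0}) =
      ((Q * s ^ 2 - 1) * Q * G (p ^ (2 * k + 1)) +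
        (G (p * p ^ (2 * k + 1)) + (Q - 1) * G 0)) +
      ((Q * s ^ 2) ^ 2 - 1 - (Q * s ^ 2 - 1) * s ^ 2 -
          (Q * s ^ 2 - 1) * (s ^ 2 - 1) / (Q ^ 2 - 1)) *
        (Q * s ^ 2 * (G (p ^ (2 * k + 1)) + (Q - 1) / 2 *
          (G (p ^ (2 * k + 1) + p ^ (k + 1)) + G (p ^ (2 * k + 1) - p ^ (k + 1))))) +
      (Q * s ^ 2 - 1) * s * (s + 1) / 2 *
        ((Q * s ^ 2 - s ^ 2) * Q * G (p ^ (2 * k + 1)) +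
          s ^ 2 * (G (p ^ (2 * k + 1) + (p - 1) * p ^ (k + 1)) +
            (Q - 1) * G (p ^ (2 * k + 1) - p ^ (k + 1)))) +
      (Q * s ^ 2 - 1) * s * (s - 1) / 2 *
        ((Q * s ^ 2 - s ^ 2) * Q * G (p ^ (2 * k + 1)) +
          s ^ 2 * (G (p ^ (2 * k + 1) - (p - 1) * p ^ (k + 1)) +
            (Q - 1) * G (p ^ (2 * k + 1) + p ^ (k + 1)))) +
      (Q * s ^ 2 - 1) * (s ^ 2 - 1) / (Q ^ 2 - 1) *
        ((Q * s ^ 2 - s ^ 2 / Q) * Q * G (p ^ (2 * k + 1)) +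
          s ^ 2 / Q * (G (p ^ (2 * k + 1)) + (Q - 1) / 2 *
          (G (p ^ (2 * k + 1) + p ^ (k + 2)) + G (p ^ (2 * k + 1) - p ^ (k + 2))))) := by
  have hchar : CharP F p := charP_of_injective_algebraMap (algebraMap (ZMod p) F).injective p
  have hK : ringChar (ZMod p) ≠ 2 := by rwa [ZMod.ringChar_zmod_n]
  have hF2 : (2 : F) ≠ 0 := Ring.two_ne_zero (by rwa [ringChar.eq F p])
  have : Module.Finite (ZMod p) F := Module.Finite.of_finite
  let e := LinearMap.BilinForm.toDual (Algebra.traceForm (ZMod p) F)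
    (traceForm_nondegenerate (ZMod p) F)
  let _ : Fintype (Module.Dual (ZMod p) F) := Fintype.ofEquiv F e.toEquiv
  rw [← sum_zeros_twistedForm hK hF2 (frobeniusPow p l F)
    (mem_range_of_frobeniusPow_eq p l F hml hF) hk (ZMod.card p) hF G hQ hs,
    Fintype.sum_prod_type]
  refine Finset.sum_congr rfl fun ab _ => ?_
  rw [Fintype.sum_prod_type, ← e.toEquiv.sum_comp]
  refine Finset.sum_congr rfl fun c _ => Finset.sum_congr rfl fun h _ => ?_
  congr 3
  simp only [traceWord_apply_eq]
  rfl

/-- A nonzero parameter gives a word with few zeros. -/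
theorem eq_zero_of_card_zeros [DecidableEq F] (hp : p ≠ 2) {k : ℕ} (hk : 1 ≤ k)
    (hml : Nat.gcd (2 * k + 1) l = 1) (hF : Fintype.card F = p ^ (2 * k + 1))
    {u : (F × F) × F × ZMod p}
    (hu : p ^ (2 * k + 1) + p ^ (k + 2) < p * #{x | traceWord p l F u x = 0}) : u = 0 := by
  classical
  have hp3 : 3 ≤ p := by
    have := (Fact.out : p.Prime).two_le
    omega
  have hpk : 0 < p ^ (k + 1) := pow_pos (by omega) _
  -- Test function: the indicator of exceeding p^{2k+1} + p^{k+2}, the largest value from corank 2.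
  -- Only the term of the everywhere vanishing word survives, with coefficient 1.
  have hz := sum_zeros_traceWord p l F hp hk hml hF
    (fun N => if (p : ℤ) ^ (2 * k + 1) + (p : ℤ) ^ (k + 2) < N then 1 else 0) rfl rfl
  have e2 : (p : ℤ) ^ (k + 2) = p * p ^ (k + 1) := by ring
  have hP : (3 : ℤ) ≤ p := by exact_mod_cast hp3
  have hPk : (0 : ℤ) < p ^ (k + 1) := by exact_mod_cast hpk
  have hle : (p : ℤ) ^ (k + 2) ≤ p ^ (2 * k + 1) := pow_le_pow_right₀ (by linarith) (by omega)
  rw [if_neg (by nlinarith), if_pos (by nlinarith), if_neg (by nlinarith), if_neg (by nlinarith),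
    if_neg (by nlinarith), if_neg (by nlinarith), if_neg (by nlinarith), if_neg (by nlinarith),
    if_neg (by nlinarith)] at hz
  simp only [mul_zero, add_zero, zero_add, Finset.sum_boole] at hz
  have hcard : #{u : (F × F) × F × ZMod p | (p : ℤ) ^ (2 * k + 1) + (p : ℤ) ^ (k + 2) <
      p * #{x | traceWord p l F u x = 0}} = 1 := by exact_mod_cast hz
  obtain ⟨v, hv⟩ := Finset.card_eq_one.1 hcard
  have h1 : u ∈ ({v} : Finset ((F × F) × F × ZMod p)) := by
    rw [← hv, Finset.mem_filter]
    exact ⟨Finset.mem_univ _, by exact_mod_cast hu⟩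
  have h2 : (0 : (F × F) × F × ZMod p) ∈ ({v} : Finset ((F × F) × F × ZMod p)) := by
    rw [← hv, Finset.mem_filter]
    refine ⟨Finset.mem_univ _, ?_⟩
    simp only [map_zero, Pi.zero_apply, Finset.filter_true, Finset.card_univ, hF]
    push_cast
    nlinarith
  rw [Finset.mem_singleton] at h1 h2
  rw [h1, h2]

theorem traceWord_injective (hp : p ≠ 2) {k : ℕ} (hk : 1 ≤ k)
    (hml : Nat.gcd (2 * k + 1) l = 1) (hF : Fintype.card F = p ^ (2 * k + 1)) :
    Function.Injective (traceWord p l F) := by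
  classical
  rw [injective_iff_map_eq_zero]
  intro u hu
  apply eq_zero_of_card_zeros p l F hp hk hml hF
  have hp3 : 3 ≤ p := by
    have := (Fact.out : p.Prime).two_le
    omega
  have hle : p ^ (k + 2) ≤ p ^ (2 * k + 1) := Nat.pow_le_pow_right (by omega) (by omega)
  have hpos : 0 < p ^ (2 * k + 1) := pow_pos (by omega) _
  simp only [hu, Pi.zero_apply, Finset.filter_true, Finset.card_univ, hF]
  nlinarith

theorem weightCount_traceCode [DecidableEq F] (hp : p ≠ 2) {k : ℕ} (hk : 1 ≤ k)
    (hml : Nat.gcd (2 * k + 1) l = 1) (hF : Fintype.card F = p ^ (2 * k + 1)) {i : ℕ} {N : ℤ}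
    (hN : N = p * (p ^ (2 * k + 1) - i)) :
    (weightCount (traceCode p l F) i : ℚ) =
      ∑ u, if (p : ℤ) * #{x | traceWord p l F u x = 0} = N then 1 else 0 := by
  have hp0 : (p : ℤ) ≠ 0 := by exact_mod_cast (Fact.out : p.Prime).ne_zero
  rw [Finset.sum_boole, weightCount]
  norm_cast
  rw [← Set.ncard_coe_finset,
    ← Set.ncard_image_of_injective _ (traceWord_injective p l F hp hk hml hF)]
  congr 1
  ext f
  simp only [Set.mem_image, Finset.coe_filter, Finset.mem_univ, true_and, mem_traceCode_iff,
    Set.mem_ofPred_eq]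
  have key : ∀ u, (p : ℤ) * #{x | traceWord p l F u x = 0} = N ↔
      hammingNorm (traceWord p l F u) = i := by
    intro u
    have := card_zeros_add_hammingNorm (traceWord p l F u)
    rw [hF] at this
    have h2 : (#{x | traceWord p l F u x = 0} : ℤ) + hammingNorm (traceWord p l F u) =
      (p : ℤ) ^ (2 * k + 1) := by exact_mod_cast this
    rw [hN, mul_right_inj' hp0]
    omega
  constructor
  · rintro ⟨⟨u, rfl⟩, h⟩
    exact ⟨u, (key u).2 h, rfl⟩
  · rintro ⟨u, h, rfl⟩
    exact ⟨⟨u, rfl⟩, (key u).1 h⟩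

variable {p l F}

/-- The code is invariant under the affine permutations of the field. -/
theorem comp_affine_mem_traceCode {f : F → ZMod p} (hf : f ∈ traceCode p l F) (α β : F) :
    (fun x => f (α * x + β)) ∈ traceCode p l F := by
  obtain ⟨u, rfl⟩ := (mem_traceCode_iff p l F f).1 hf
  obtain ⟨⟨a, b⟩, c, h⟩ := u
  set σ := frobeniusPow p l F with hσ
  rw [mem_traceCode_iff]
  -- The cross term Tr(aσ(α)β·σ(x)) is made linear in x by applying σ⁻¹ under the trace.
  refine ⟨((a * (σ α * α), b * α ^ 2),
    σ.symm (a * σ α * β) + a * σ β * α + 2 * b * α * β + c * α,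
    h + Algebra.trace (ZMod p) F (a * (σ β * β) + b * β ^ 2 + c * β)), ?_⟩
  funext x
  have h1 : Algebra.trace (ZMod p) F (σ.symm (a * σ α * β) * x) =
      Algebra.trace (ZMod p) F (a * σ α * β * σ x) := by
    rw [← Algebra.trace_eq_of_algEquiv σ, map_mul, AlgEquiv.apply_symm_apply]
  have h2 : ∀ (a b c : F) (h : ZMod p) (x : F), traceWord p l F ((a, b), c, h) x =
      Algebra.trace (ZMod p) F (a * (σ x * x) + b * x ^ 2 + c * x) + h := by
    intro a b c h x
    rw [hσ, frobeniusPow_apply, ← pow_succ]; rfl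
  rw [h2, h2]
  have e1 : a * (σ α * α) * (σ x * x) + b * α ^ 2 * x ^ 2 +
      (σ.symm (a * σ α * β) + a * σ β * α + 2 * b * α * β + c * α) * x =
      σ.symm (a * σ α * β) * x + (a * (σ α * α) * (σ x * x) + b * α ^ 2 * x ^ 2 +
      (a * σ β * α + 2 * b * α * β + c * α) * x) := by ring
  have e2 : a * (σ (α * x + β) * (α * x + β)) + b * (α * x + β) ^ 2 + c * (α * x + β) =
      a * σ α * β * σ x + (a * (σ α * α) * (σ x * x) + b * α ^ 2 * x ^ 2 +
      (a * σ β * α + 2 * b * α * β + c * α) * x) +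
      (a * (σ β * β) + b * β ^ 2 + c * β) := by
    rw [map_add, map_mul]; ring
  have e3 : ∀ u v w : F, Algebra.trace (ZMod p) F (u + v + w) = Algebra.trace (ZMod p) F u +
      Algebra.trace (ZMod p) F v + Algebra.trace (ZMod p) F w := fun u v w => by
    rw [map_add, map_add]
  have e4 : ∀ u v : F, Algebra.trace (ZMod p) F (u + v) = Algebra.trace (ZMod p) F u +
      Algebra.trace (ZMod p) F v := fun u v => map_add _ u v
  rw [e1, e2, e3 (a * σ α * β * σ x), e4 (σ.symm _ * x), h1]
  ring

/-- Affine maps act 2-transitively: z ↦ (y - x)z + x carries {0, 1} to {x, y}. -/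
theorem ncard_supportBlocks_pair [DecidableEq F] (i : ℕ) (T : Finset F) (hT : T.card = 2) :
    {B ∈ supportBlocks (traceCode p l F) i | T ⊆ B}.ncard =
      {B ∈ supportBlocks (traceCode p l F) i | ({0, 1} : Finset F) ⊆ B}.ncard := by
  obtain ⟨x, y, hxy, rfl⟩ := Finset.card_eq_two.1 hT
  have hα : y - x ≠ 0 := sub_ne_zero.2 hxy.symm
  let τ : F ≃ F := (Equiv.mulLeft₀ (y - x) hα).trans (Equiv.addRight x)
  have hτ : ∀ z, τ z = (y - x) * z + x := fun z => rfl
  have hmap : ({x, y} : Finset F) = ({0, 1} : Finset F).map τ.toEmbedding := by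
    rw [Finset.map_insert, Finset.map_singleton]
    simp [hτ]
  rw [hmap]
  refine ncard_supportBlocks_map _ i τ (fun f => ⟨fun hf => ?_, fun hf => ?_⟩) _
  · exact comp_affine_mem_traceCode hf (y - x) x
  · convert comp_affine_mem_traceCode hf (y - x)⁻¹ (-((y - x)⁻¹ * x)) using 1
    funext z
    simp only [Function.comp_apply, hτ]
    congr 1
    field_simp
    ring

end TraceCode

/-! ### From the weight distribution to design parameters. -/

section DesignParameters

variable {p l : ℕ} [Fact p.Prime] {F : Type*} [Field F] [Fintype F] [Algebra (ZMod p) F]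

/-- Words of the trace code whose weight is not too large are determined by their supports up to
scalars. -/
theorem exists_eq_smul_of_wordSupport_eq (hp : p ≠ 2) {k : ℕ} (hk : 1 ≤ k)
    (hml : Nat.gcd (2 * k + 1) l = 1) (hF : Fintype.card F = p ^ (2 * k + 1)) {i : ℕ}
    (hi : p * ((p - 1) * (p ^ (2 * k) + p ^ (k + 1))) <
      p * ((p - 1) * (p ^ (2 * k + 1) - i) + i))
    (f : F → ZMod p) (hf : f ∈ traceCode p l F) (g : F → ZMod p) (hg : g ∈ traceCode p l F)
    (hfi : hammingNorm f = i) (hfg : wordSupport f = wordSupport g) :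
    ∃ c : ZMod p, f = c • g := by
  classical
  obtain ⟨c, hc⟩ := exists_smul_card_zeros f g hfi hfg
  refine ⟨c, ?_⟩
  obtain ⟨u, hu⟩ := (mem_traceCode_iff p l F _).1
    ((traceCode p l F).sub_mem hf ((traceCode p l F).smul_mem c hg))
  rw [hF, ← hu] at hc
  have hp1 : 0 < p - 1 := by
    have := (Fact.out : p.Prime).two_le
    omega
  have h0 : u = 0 := by
    apply eq_zero_of_card_zeros p l F hp hk hml hF
    apply lt_of_mul_lt_mul_left (a := p - 1) _ (Nat.zero_le _)
    calc (p - 1) * (p ^ (2 * k + 1) + p ^ (k + 2))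
        = p * ((p - 1) * (p ^ (2 * k) + p ^ (k + 1))) := by ring
      _ < p * ((p - 1) * (p ^ (2 * k + 1) - i) + i) := hi
      _ ≤ p * ((p - 1) * #{x | traceWord p l F u x = 0}) := by gcongr
      _ = _ := by ring
  rw [h0, map_zero] at hu
  exact (sub_eq_zero.1 hu.symm)

/-- The number of words of weight `(p - 1) p ^ (2 k) - δ p ^ k`, where `g` is the indicator function
of `δ`, `Q = p` and `s = p ^ k`. -/
def weightNumber (Q s : ℚ) (δ : ℤ) (p : ℤ) : ℚ :=
  let g : ℤ → ℚ := fun e => if e = δ then 1 else 0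
  (Q * s ^ 2 - 1) * Q * g 0 +
  ((Q * s ^ 2) ^ 2 - 1 - (Q * s ^ 2 - 1) * s ^ 2 -
      (Q * s ^ 2 - 1) * (s ^ 2 - 1) / (Q ^ 2 - 1)) *
    (Q * s ^ 2 * (g 0 + (Q - 1) / 2 * (g 1 + g (-1)))) +
  (Q * s ^ 2 - 1) * s * (s + 1) / 2 *
    ((Q * s ^ 2 - s ^ 2) * Q * g 0 + s ^ 2 * (g (p - 1) + (Q - 1) * g (-1))) +
  (Q * s ^ 2 - 1) * s * (s - 1) / 2 *
    ((Q * s ^ 2 - s ^ 2) * Q * g 0 + s ^ 2 * (g (-(p - 1)) + (Q - 1) * g 1)) +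
  (Q * s ^ 2 - 1) * (s ^ 2 - 1) / (Q ^ 2 - 1) *
    ((Q * s ^ 2 - s ^ 2 / Q) * Q * g 0 + s ^ 2 / Q * (g 0 + (Q - 1) / 2 * (g p + g (-p))))

theorem weightCount_eq_weightNumber (hp : p ≠ 2) {k : ℕ} (hk : 1 ≤ k)
    (hml : Nat.gcd (2 * k + 1) l = 1) (hF : Fintype.card F = p ^ (2 * k + 1)) {i : ℕ} {δ : ℤ}
    (hi : (i : ℤ) = (p - 1) * p ^ (2 * k) - δ * p ^ k) (hδ : -(p : ℤ) ^ k < δ)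
    (hδ' : δ < (p - 1) * (p : ℤ) ^ k) :
    (weightCount (traceCode p l F) i : ℚ) = weightNumber (p : ℚ) ((p : ℚ) ^ k) δ p := by
  classical
  have hp0 : (0 : ℤ) < p := by exact_mod_cast (Fact.out : p.Prime).pos
  have hpk : (0 : ℤ) < p ^ (k + 1) := by positivity
  have hN : (p : ℤ) ^ (2 * k + 1) + δ * p ^ (k + 1) = p * (p ^ (2 * k + 1) - i) := by
    rw [hi]; ring
  rw [weightCount_traceCode p l F hp hk hml hF hN,
    sum_zeros_traceWord p l F hp hk hml hF
      (fun N => if N = (p : ℤ) ^ (2 * k + 1) + δ * p ^ (k + 1) then 1 else 0) rfl rfl]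
  have key : ∀ (N e : ℤ), N = (p : ℤ) ^ (2 * k + 1) + e * p ^ (k + 1) →
      (N = (p : ℤ) ^ (2 * k + 1) + δ * p ^ (k + 1) ↔ e = δ) := by
    rintro _ e rfl
    rw [add_right_inj, mul_left_inj' hpk.ne']
  have s1 := key (p ^ (2 * k + 1)) 0 (by ring)
  -- This and the next value come from the zero word and the nonzero constant words; the bounds on δ
  -- exclude both.
  have s2 := key (p * p ^ (2 * k + 1)) ((p - 1) * p ^ k) (by ring)
  have s3 := key 0 (- p ^ k) (by ring)
  have s4 := key (p ^ (2 * k + 1) + p ^ (k + 1)) 1 (by ring)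
  have s5 := key (p ^ (2 * k + 1) - p ^ (k + 1)) (-1) (by ring)
  have s6 := key (p ^ (2 * k + 1) + (p - 1) * p ^ (k + 1)) (p - 1) (by ring)
  have s7 := key (p ^ (2 * k + 1) - (p - 1) * p ^ (k + 1)) (-(p - 1)) (by ring)
  have s8 := key (p ^ (2 * k + 1) + p ^ (k + 2)) p (by ring)
  have s9 := key (p ^ (2 * k + 1) - p ^ (k + 2)) (-p) (by ring)
  simp only [s1, s2, s3, s4, s5, s6, s7, s8, s9, weightNumber, if_neg hδ.ne, if_neg hδ'.ne',
    mul_zero, add_zero]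

/-- Common core of all cases. The hypothesis `hL` is λ·v(v-1) = (A_i/(p-1))·i(i-1) with v = Qs² and
the denominator p - 1 cleared. The alternative `h3` is what makes the pigeonhole margin positive. -/
theorem isTDesign_of_weight (hp : p ≠ 2) {m k : ℕ} (hm : m = 2 * k + 1) (hk : 1 ≤ k)
    (hml : Nat.gcd m l = 1) (hF : Fintype.card F = p ^ m) {δ : ℤ}
    (h1 : -(p : ℤ) ≤ δ) (h2 : δ ≤ p) (h3 : 2 ≤ k ∨ 0 < δ) {I L Q s : ℚ}
    (hQ : (p : ℚ) = Q) (hs : (p : ℚ) ^ k = s) (hI : I = (Q - 1) * s ^ 2 - δ * s)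
    (hA : weightNumber Q s δ p ≠ 0)
    (hL : L * ((Q - 1) * (Q * s ^ 2 * (Q * s ^ 2 - 1))) = weightNumber Q s δ p * (I * (I - 1))) :
    ∃ i lam : ℕ, (i : ℚ) = I ∧ (lam : ℚ) = L ∧ weightCount (traceCode p l F) i ≠ 0 ∧
      IsTDesign (supportBlocks (traceCode p l F) i) 2 (p ^ m) i lam ∧
      (p - 1) * (supportBlocks (traceCode p l F) i).ncard = weightCount (traceCode p l F) i := by
  classical
  subst hm
  have hp3 : 3 ≤ p := by
    have := (Fact.out : p.Prime).two_le
    omega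
  have hP : (3 : ℤ) ≤ p := by exact_mod_cast hp3
  have hsp : (p : ℤ) ≤ p ^ k := by
    calc (p : ℤ) = p ^ 1 := (pow_one _).symm
      _ ≤ p ^ k := pow_le_pow_right₀ (by linarith) hk
  have hδ : -(p : ℤ) ^ k < δ := by
    rcases h3 with h | h
    · have : (p : ℤ) ^ 2 ≤ p ^ k := pow_le_pow_right₀ (by linarith) h
      nlinarith
    · linarith
  have hδ' : δ + 1 < (p - 1) * (p : ℤ) ^ k := by nlinarith
  have hpow : (p : ℤ) ^ (2 * k) = p ^ k * p ^ k := by ring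
  set S : ℤ := (p : ℤ) ^ k with hS
  obtain ⟨i, hi⟩ : ∃ i : ℕ, (i : ℤ) = (p - 1) * p ^ (2 * k) - δ * p ^ k := by
    refine ⟨((p - 1) * (p : ℤ) ^ (2 * k) - δ * p ^ k).toNat, Int.toNat_of_nonneg ?_⟩
    rw [hpow, ← hS]; nlinarith
  have hi2 : 2 < i := by
    have : (2 : ℤ) < i := by
      rw [hi, hpow, ← hS]; nlinarith
    exact_mod_cast this
  have hiv : i < p ^ (2 * k + 1) := by
    have : (i : ℤ) < p ^ (2 * k + 1) := by
      rw [hi, pow_succ, hpow, ← hS]; nlinarith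
    exact_mod_cast this
  have hcond : p * ((p - 1) * (p ^ (2 * k) + p ^ (k + 1))) <
      p * ((p - 1) * (p ^ (2 * k + 1) - i) + i) := by
    apply Nat.mul_lt_mul_of_pos_left _ (by omega)
    zify [hiv.le, (by omega : 1 ≤ p)]
    rw [hi, pow_succ _ (2 * k), hpow, pow_succ _ k, ← hS]
    -- The multiplicity condition divided by common factors. For k = 1 one has S = p, so it amounts
    -- to δ > 0; for k ≥ 2 the bound S ≥ p² absorbs any δ ≥ -p.
    have hlt : ((p : ℤ) - 1) * p < (p - 1) * S + (p - 2) * δ := by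
      rcases h3 with h | h
      · have : (p : ℤ) ^ 2 ≤ p ^ k := pow_le_pow_right₀ (by linarith) h
        rw [← hS] at this
        nlinarith
      · nlinarith
    nlinarith
  have hmult := exists_eq_smul_of_wordSupport_eq (F := F) hp hk hml hF hcond
  have hblocks := card_supportBlocks (traceCode p l F) (by omega : 0 < i) hmult
  have hW := weightCount_eq_weightNumber (F := F) hp hk hml hF hi hδ (by linarith)
  rw [hs, hQ] at hW
  have hiI : (i : ℚ) = I := by
    have := congrArg (Int.cast : ℤ → ℚ) hi
    push_cast at this
    rw [this, hI, hQ, ← hs, ← hQ]; ring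
  set lam := {B ∈ supportBlocks (traceCode p l F) i | ({0, 1} : Finset F) ⊆ B}.ncard with hlam
  have hcard : ∀ B ∈ supportBlocks (traceCode p l F) i, B.card = i := by
    rintro _ ⟨f, _, hfi, rfl⟩
    exact hfi
  have hcount := ncard_mul_of_pair_regular hcard
    (fun T hT => ncard_supportBlocks_pair (p := p) (l := l) i T hT)
  rw [← hlam] at hcount
  refine ⟨i, lam, hiI, ?_, ?_, ⟨hF, by norm_num, hi2, hiv, hcard,
    fun T hT => ncard_supportBlocks_pair i T hT⟩, hblocks⟩
  · have hFq : (Fintype.card F : ℚ) = Q * s ^ 2 := by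
      rw [hF, ← hs, ← hQ]; push_cast; ring
    have hQ3 : 3 ≤ Q := by rw [← hQ]; exact_mod_cast hp3
    have hs3 : 3 ≤ s := by
      have : (3 : ℤ) ≤ (p : ℤ) ^ k := by rw [← hS]; linarith
      rw [← hs]; exact_mod_cast this
    have hne : (Q - 1) * (Q * s ^ 2 * (Q * s ^ 2 - 1)) ≠ 0 := by
      have h1 : 0 < Q - 1 := by linarith
      have h2 : 0 < Q * s ^ 2 := by positivity
      have h3 : 0 < Q * s ^ 2 - 1 := by nlinarith
      positivity
    apply mul_right_cancel₀ hne
    rw [hL, ← hW, ← hblocks, ← hiI]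
    have e1 : i ≤ i * i := Nat.le_mul_self i
    have e2 : Fintype.card F ≤ Fintype.card F * Fintype.card F := Nat.le_mul_self _
    have hc := congrArg (Nat.cast : ℕ → ℚ) hcount
    rw [Nat.cast_mul, Nat.cast_mul, Nat.cast_sub e1, Nat.cast_sub e2, Nat.cast_mul, Nat.cast_mul,
      hFq] at hc
    rw [Nat.cast_mul, Nat.cast_sub (by omega), hQ, Nat.cast_one]
    linear_combination (-(Q - 1)) * hc
  · intro h0
    rw [h0, Nat.cast_zero] at hW
    exact hA hW.symm

end DesignParameters

/-! ### Closed forms and positivity of the weight numbers. -/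

section WeightNumbers

variable {Q s : ℚ} {p : ℤ}

theorem corank_zero_count_factor (hQ : 3 ≤ Q) :
    (Q * s ^ 2) ^ 2 - 1 - (Q * s ^ 2 - 1) * s ^ 2 -
      (Q * s ^ 2 - 1) * (s ^ 2 - 1) / (Q ^ 2 - 1) =
      (Q * s ^ 2 - 1) * (Q * s ^ 2 + 1 - s ^ 2 - (s ^ 2 - 1) / (Q ^ 2 - 1)) := by
  have : Q ^ 2 - 1 ≠ 0 := by nlinarith
  field_simp
  ring

theorem corank_zero_count_pos (hQ : 3 ≤ Q) (hs : 3 ≤ s) :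
    0 < (Q * s ^ 2) ^ 2 - 1 - (Q * s ^ 2 - 1) * s ^ 2 -
      (Q * s ^ 2 - 1) * (s ^ 2 - 1) / (Q ^ 2 - 1) := by
  rw [corank_zero_count_factor hQ]
  have h1 : 0 < Q * s ^ 2 - 1 := by nlinarith
  have h2 : (s ^ 2 - 1) / (Q ^ 2 - 1) ≤ s ^ 2 := by
    rw [div_le_iff₀ (by nlinarith)]
    nlinarith [sq_nonneg s, mul_nonneg (sq_nonneg s) (by nlinarith : (0 : ℚ) ≤ Q ^ 2 - 2)]
  exact mul_pos h1 (by nlinarith)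

/-- As p ≥ 3, the values 0, ±1, ±(p-1), ±p are distinct, so each indicator picks out its own terms;
δ = ±p occurs only in corank 2. -/
theorem weightNumber_self (hp : 3 ≤ p) : weightNumber Q s p p =
    (Q * s ^ 2 - 1) * (s ^ 2 - 1) / (Q ^ 2 - 1) * (s ^ 2 / Q * ((Q - 1) / 2)) := by
  simp (disch := omega) only [weightNumber, if_neg, if_true]; ring

theorem weightNumber_neg_self (hp : 3 ≤ p) : weightNumber Q s (-p) p =
    (Q * s ^ 2 - 1) * (s ^ 2 - 1) / (Q ^ 2 - 1) * (s ^ 2 / Q * ((Q - 1) / 2)) := by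
  simp (disch := omega) only [weightNumber, if_neg, if_true]; ring

theorem weightNumber_sub_one (hp : 3 ≤ p) : weightNumber Q s (p - 1) p =
    (Q * s ^ 2 - 1) * s * (s + 1) / 2 * s ^ 2 := by
  simp (disch := omega) only [weightNumber, if_neg, if_true]; ring

theorem weightNumber_neg_sub_one (hp : 3 ≤ p) : weightNumber Q s (-(p - 1)) p =
    (Q * s ^ 2 - 1) * s * (s - 1) / 2 * s ^ 2 := by
  simp (disch := omega) only [weightNumber, if_neg, if_true]; ring

theorem weightNumber_one (hp : 3 ≤ p) : weightNumber Q s 1 p =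
    ((Q * s ^ 2) ^ 2 - 1 - (Q * s ^ 2 - 1) * s ^ 2 -
      (Q * s ^ 2 - 1) * (s ^ 2 - 1) / (Q ^ 2 - 1)) * (Q * s ^ 2 * ((Q - 1) / 2)) +
    (Q * s ^ 2 - 1) * s * (s - 1) / 2 * (s ^ 2 * (Q - 1)) := by
  simp (disch := omega) only [weightNumber, if_neg, if_true]; ring

theorem weightNumber_neg_one (hp : 3 ≤ p) : weightNumber Q s (-1) p =
    ((Q * s ^ 2) ^ 2 - 1 - (Q * s ^ 2 - 1) * s ^ 2 -
      (Q * s ^ 2 - 1) * (s ^ 2 - 1) / (Q ^ 2 - 1)) * (Q * s ^ 2 * ((Q - 1) / 2)) +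
    (Q * s ^ 2 - 1) * s * (s + 1) / 2 * (s ^ 2 * (Q - 1)) := by
  simp (disch := omega) only [weightNumber, if_neg, if_true]; ring

theorem weightNumber_zero (hp : 3 ≤ p) : weightNumber Q s 0 p =
    (Q * s ^ 2 - 1) * Q +
    ((Q * s ^ 2) ^ 2 - 1 - (Q * s ^ 2 - 1) * s ^ 2 -
      (Q * s ^ 2 - 1) * (s ^ 2 - 1) / (Q ^ 2 - 1)) * (Q * s ^ 2) +
    (Q * s ^ 2 - 1) * s ^ 2 * ((Q * s ^ 2 - s ^ 2) * Q) +
    (Q * s ^ 2 - 1) * (s ^ 2 - 1) / (Q ^ 2 - 1) *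
      ((Q * s ^ 2 - s ^ 2 / Q) * Q + s ^ 2 / Q) := by
  simp (disch := omega) only [weightNumber, if_neg, if_true]; ring

theorem weightNumber_ne_zero (hQ : 3 ≤ Q) (hs : 3 ≤ s) (hp : 3 ≤ p) {δ : ℤ}
    (hδ : δ ∈ ({p, -p, p - 1, -(p - 1), 1, -1, 0} : Finset ℤ)) : weightNumber Q s δ p ≠ 0 := by
  have h0 := corank_zero_count_pos hQ hs
  have h1 : 0 < Q * s ^ 2 - 1 := by nlinarith
  have h2 : 0 < s ^ 2 - 1 := by nlinarith
  have h3 : 0 < Q ^ 2 - 1 := by nlinarith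
  have h4 : 0 < Q - 1 := by linarith
  have h5 : 0 < s - 1 := by linarith
  have h6 : 0 < Q * s ^ 2 - s ^ 2 := by nlinarith
  have hQ0 : 0 < Q := by linarith
  have hs0 : 0 < s := by linarith
  have h7 : 0 < Q * s ^ 2 - s ^ 2 / Q := by
    rw [sub_pos, div_lt_iff₀ hQ0]; nlinarith
  set n₀ := (Q * s ^ 2) ^ 2 - 1 - (Q * s ^ 2 - 1) * s ^ 2 -
      (Q * s ^ 2 - 1) * (s ^ 2 - 1) / (Q ^ 2 - 1) with hn
  apply ne_of_gt
  simp only [Finset.mem_insert, Finset.mem_singleton] at hδ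
  rcases hδ with rfl | rfl | rfl | rfl | rfl | rfl | rfl
  · rw [weightNumber_self hp]; positivity
  · rw [weightNumber_neg_self hp]; positivity
  · rw [weightNumber_sub_one hp]; positivity
  · rw [weightNumber_neg_sub_one hp]; positivity
  · rw [weightNumber_one hp, ← hn]; positivity
  · rw [weightNumber_neg_one hp, ← hn]; positivity
  · rw [weightNumber_zero hp, ← hn]; positivity

end WeightNumbers

theorem theorem4p3 (p : ℕ) [Fact p.Prime] (hp : p ≠ 2) (m l : ℕ) (hm : Odd m) (hl : 0 < l)
    (hml : Nat.gcd m l = 1) (F : Type*) [Field F] [Fintype F] [Algebra (ZMod p) F]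
    (hF : Fintype.card F = p ^ m) :
    let C := traceCode p l F
    let P : ℚ := p
    (5 ≤ m → ∀ d ∈ ([
        (P ^ m - P ^ (m - 1) - P ^ ((m + 1) / 2),
          P ^ ((m - 3) / 2) * (P ^ ((m - 1) / 2) - P ^ ((m - 3) / 2) - 1) * (P ^ (m - 1) - 1)
            * (P ^ m - P ^ (m - 1) - P ^ ((m + 1) / 2) - 1) / (2 * (P ^ 2 - 1))),
        (P ^ m - P ^ (m - 1) - P ^ ((m - 1) / 2) * (P - 1),
          P ^ (m - 2) * (P ^ (m - 1) - 1)
            * (P ^ m - P ^ (m - 1) - P ^ ((m + 1) / 2) + P ^ ((m - 1) / 2) - 1) / 2),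
        (P ^ m - P ^ (m - 1) - P ^ ((m - 1) / 2),
          P ^ ((m - 1) / 2) * (P ^ ((m + 1) / 2) - P ^ ((m - 1) / 2) - 1)
            * (P ^ m - P ^ (m - 1) - P ^ ((m - 1) / 2) - 1)
            * (P ^ (m + 2) - P ^ (m + 1) - P ^ (m - 2) - P ^ ((m + 1) / 2)
                + P ^ ((m - 3) / 2) + P ^ 2) / (2 * (P ^ 2 - 1))),
        (P ^ m - P ^ (m - 1),
          (P ^ m - P ^ (m - 1) - 1)
            * (2 * P ^ (2 * m - 1) - 2 * P ^ (2 * m - 2) + P ^ (2 * m - 3) - P ^ (2 * m - 4)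
                + P ^ (m - 1) - P ^ (m - 2) + P ^ (m - 3) + 1)),
        (P ^ m - P ^ (m - 1) + P ^ ((m - 1) / 2),
          P ^ ((m - 1) / 2) * (P ^ ((m + 1) / 2) - P ^ ((m - 1) / 2) + 1)
            * (P ^ m - P ^ (m - 1) + P ^ ((m - 1) / 2) - 1)
            * (P ^ (m + 2) - P ^ (m + 1) - P ^ (m - 2) + P ^ ((m + 1) / 2)
                - P ^ ((m - 3) / 2) + P ^ 2) / (2 * (P ^ 2 - 1))),
        (P ^ m - P ^ (m - 1) + P ^ ((m + 1) / 2),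
          P ^ ((m - 3) / 2) * (P ^ ((m - 1) / 2) - P ^ ((m - 3) / 2) + 1)
            * (P ^ m - P ^ (m - 1) + P ^ ((m + 1) / 2) - 1) * (P ^ (m - 1) - 1)
            / (2 * (P ^ 2 - 1))),
        (P ^ m - P ^ (m - 1) + P ^ ((m - 1) / 2) * (P - 1),
          P ^ (m - 2) * (P ^ (m - 1) - 1)
            * (P ^ m - P ^ (m - 1) + P ^ ((m - 1) / 2) * (P - 1) - 1) / 2)] : List (ℚ × ℚ)),
      ∃ i lam : ℕ, (i : ℚ) = d.1 ∧ (lam : ℚ) = d.2 ∧ weightCount C i ≠ 0 ∧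
        IsTDesign (supportBlocks C i) 2 (p ^ m) i lam ∧
        (p - 1) * (supportBlocks C i).ncard = weightCount C i) ∧
    (m = 3 → ∀ d ∈ ([
        (P ^ 3 - 2 * P ^ 2, (P - 2) * (P ^ 3 - 2 * P ^ 2 - 1) / 2),
        (P ^ 3 - 2 * P ^ 2 + P, P * (P ^ 2 - 1) * (P ^ 3 - 2 * P ^ 2 + P - 1) / 2),
        (P ^ 3 - P ^ 2 - P,
          P * (P ^ 2 - P - 1) * (P ^ 3 - P ^ 2 - P - 1) * (P ^ 5 - P ^ 4 - P + 1)
            / (2 * (P ^ 2 - 1)))] : List (ℚ × ℚ)),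
      ∃ i lam : ℕ, (i : ℚ) = d.1 ∧ (lam : ℚ) = d.2 ∧ weightCount C i ≠ 0 ∧
        IsTDesign (supportBlocks C i) 2 (p ^ m) i lam ∧
        (p - 1) * (supportBlocks C i).ncard = weightCount C i) := by
  intro C P
  obtain ⟨k, hk⟩ := hm
  have hp3 : 3 ≤ p := by
    have := (Fact.out : p.Prime).two_le
    omega
  have hZ : (3 : ℤ) ≤ p := by exact_mod_cast hp3
  have hP : (p : ℚ) = P := rfl
  clear_value P
  have hP3 : (3 : ℚ) ≤ P := by rw [← hP]; exact_mod_cast hp3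
  have hP0 : P ≠ 0 := by linarith
  have hP1 : P - 1 ≠ 0 := by linarith
  have hP2 : P ^ 2 - 1 ≠ 0 := by nlinarith
  have hs3 : 1 ≤ k → 3 ≤ P ^ k := fun h => hP3.trans (by
    calc P = P ^ 1 := (pow_one P).symm
      _ ≤ P ^ k := pow_le_pow_right₀ (by linarith) h)
  refine ⟨fun h5 => ?_, fun h3 => ?_⟩
  -- Every power of P in the statement is rewritten through P and s = P^k, so that the claims become
  -- rational identities in two variables.
  · obtain ⟨s, hs⟩ : ∃ s, s = P ^ k := ⟨_, rfl⟩
    have hs3 : 3 ≤ s := hs ▸ hs3 (by omega)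
    have hs0 : s ≠ 0 := by linarith
    have x1 : P ^ m = P * s ^ 2 := by rw [hs, hk]; ring
    have x2 : P ^ (m - 1) = s ^ 2 := by
      rw [hs, hk, Nat.add_sub_cancel]; ring
    have x3 : P ^ ((m + 1) / 2) = P * s := by
      rw [hs, show (m + 1) / 2 = k + 1 by omega]; ring
    have x4 : P ^ ((m - 1) / 2) = s := by
      rw [hs, show (m - 1) / 2 = k by omega]
    have x5 : P ^ ((m - 3) / 2) = s / P := by
      rw [hs, eq_div_iff hP0, ← pow_succ]; congr 1; omega
    have x6 : P ^ (m - 2) = s ^ 2 / P := by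
      rw [hs, eq_div_iff hP0, ← pow_succ, ← pow_mul]; congr 1; omega
    have x7 : P ^ (m + 2) = P ^ 3 * s ^ 2 := by rw [hs, hk]; ring
    have x8 : P ^ (m + 1) = P ^ 2 * s ^ 2 := by rw [hs, hk]; ring
    have x9 : P ^ (2 * m - 1) = P * s ^ 4 := by
      rw [hs, show 2 * m - 1 = 4 * k + 1 by omega]; ring
    have x10 : P ^ (2 * m - 2) = s ^ 4 := by
      rw [hs, show 2 * m - 2 = 4 * k by omega]; ring
    have x11 : P ^ (2 * m - 3) = s ^ 4 / P := by
      rw [hs, eq_div_iff hP0, ← pow_succ, ← pow_mul]; congr 1; omega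
    have x12 : P ^ (2 * m - 4) = s ^ 4 / P ^ 2 := by
      rw [hs, eq_div_iff (pow_ne_zero 2 hP0), ← pow_add, ← pow_mul]; congr 1; omega
    have x13 : P ^ (m - 3) = s ^ 2 / P ^ 2 := by
      rw [hs, eq_div_iff (pow_ne_zero 2 hP0), ← pow_add, ← pow_mul]; congr 1; omega
    have main := fun (δ : ℤ) (h1 : -(p : ℤ) ≤ δ) (h2 : δ ≤ p) (I L : ℚ) =>
      isTDesign_of_weight (F := F) hp hk (by omega : 1 ≤ k) hml hF h1 h2
        (Or.inl (by omega : 2 ≤ k)) (I := I) (L := L) hP (hP ▸ hs.symm)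
    rw [x1, x2, x3, x4, x5, x6, x7, x8, x9, x10, x11, x12, x13]
    simp only [List.forall_mem_cons, List.not_mem_nil, IsEmpty.forall_iff, implies_true, and_true]
    refine ⟨main p (by omega) (by omega) _ _ ?_ (weightNumber_ne_zero hP3 hs3 hZ (by simp)) ?_,
      main (p - 1) (by omega) (by omega) _ _ ?_ (weightNumber_ne_zero hP3 hs3 hZ (by simp)) ?_,
      main 1 (by omega) (by omega) _ _ ?_ (weightNumber_ne_zero hP3 hs3 hZ (by simp)) ?_,
      main 0 (by omega) (by omega) _ _ ?_ (weightNumber_ne_zero hP3 hs3 hZ (by simp)) ?_,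
      main (-1) (by omega) (by omega) _ _ ?_ (weightNumber_ne_zero hP3 hs3 hZ (by simp)) ?_,
      main (-p) (by omega) (by omega) _ _ ?_ (weightNumber_ne_zero hP3 hs3 hZ (by simp)) ?_,
      main (-(p - 1)) (by omega) (by omega) _ _ ?_ (weightNumber_ne_zero hP3 hs3 hZ (by simp)) ?_⟩
    · push_cast [hP]; ring
    · rw [weightNumber_self hZ]; field_simp
    · push_cast [hP]; ring
    · rw [weightNumber_sub_one hZ]; field_simp; ring
    · push_cast [hP]; ring
    · rw [weightNumber_one hZ]; field_simp; ring
    · push_cast [hP]; ring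
    · rw [weightNumber_zero hZ]; field_simp; ring
    · push_cast [hP]; ring
    · rw [weightNumber_neg_one hZ]; field_simp; ring
    · push_cast [hP]; ring
    · rw [weightNumber_neg_self hZ]; field_simp
    · push_cast [hP]; ring
    · rw [weightNumber_neg_sub_one hZ]; field_simp; ring
  · have hk1 : k = 1 := by omega
    -- Here s = P, and only δ = p, p - 1, 1 are available.
    have main := fun (δ : ℤ) (h1 : 0 < δ) (h2 : δ ≤ p) (I L : ℚ) =>
      isTDesign_of_weight (F := F) hp hk hk1.ge hml hF (by omega) h2
        (Or.inr h1) (I := I) (L := L) hP (by rw [hk1, pow_one, hP] : (p : ℚ) ^ k = P)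
    simp only [List.forall_mem_cons, List.not_mem_nil, IsEmpty.forall_iff, implies_true, and_true]
    refine ⟨main p (by omega) (by omega) _ _ ?_ (weightNumber_ne_zero hP3 hP3 hZ (by simp)) ?_,
      main (p - 1) (by omega) (by omega) _ _ ?_ (weightNumber_ne_zero hP3 hP3 hZ (by simp)) ?_,
      main 1 (by omega) (by omega) _ _ ?_ (weightNumber_ne_zero hP3 hP3 hZ (by simp)) ?_⟩
    · push_cast [hP]; ring
    · rw [weightNumber_self hZ]; field_simp
    · push_cast [hP]; ring
    · rw [weightNumber_sub_one hZ]; field_simp; ring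
    · push_cast [hP]; ring
    · rw [weightNumber_one hZ]; field_simp; ring
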